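/- Let $\mathcal A,\mathcal X$ be finite sets and let $W:x\mapsto W_x$ be a classical-quantum channel, i.e. each $W_x$ ($x\in\mathcal X$) is a density matrix on a finite-dimensional Hilbert space. For a distribution $p$ on $\mathcal X$ put $W_p=\sum_x p(x)W_x$ and $\rho[W,p]=\sum_x p(x)|x\rangle\langle x|\otimes W_x$, with reduced states $\rho[W,p]_A$ and $\rho[W,p]_E$ on the first and second system. For positive semidefinite matrices $\rho,\sigma$ with $\operatorname{supp}\rho\subseteq\operatorname{supp}\sigma$, and negative powers of $\sigma$ taken on its support, let $$D(\rho\|\sigma)=\operatorname{Tr}\rho(\log\rho-\log\sigma),\qquad \underline D(\rho\|\sigma)=\operatorname{Tr}\rho\log(\sigma^{-1/2}\rho\,\sigma^{-1/2}),$$ $$\psi(s|\rho\|\sigma)=\log\operatorname{Tr}\rho^{1+s}\sigma^{-s},\qquad \underline\psi^*(s|\rho\|\sigma)=\log\operatorname{Tr}\rho(\sigma^{-1/2}\rho\,\sigma^{-1/2})^{s};$$ all four are $+\infty$ if $\operatorname{supp}\rho\not\subseteq\operatorname{supp}\sigma$. Here $\underline D(\rho\|\sigma)=-\infty$ if $\operatorname{supp}\rho\subseteq\operatorname{supp}\sigma$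 but $\rho$ does not vanish on the kernel of $\sigma^{-1/2}\rho\,\sigma^{-1/2}$. Put $\psi(s|W,p)=\psi(s|\rho[W,p]\,\|\,\rho[W,p]_A\otimes\rho[W,p]_E)$, and define $\underline\psi^*(s|W,p)$ in the same way from $\underline\psi^*$. For a distribution $P^A$ on $\mathcal A$ let $H_{1+s}(P^A)=-\frac1s\log\sum_aP^A(a)^{1+s}$. Let $P^A$ and $P^X$ be distributions on $\mathcal A$ and $\mathcal X$, and let $\Phi:\mathcal A\to\mathcal X$ be a random map such that each $\Phi(a)$ has law $P^X$ and, for $a\ne a'$, $\Phi(a)$ and $\Phi(a')$ are independent (in particular, the $\Phi(a)$ may be i.i.d. with law $P^X$). Let $P^A\circ\Phi^{-1}$ be the image of $P^A$ under $\Phi$, and let $v$ be the number of distinct eigenvalues of $W_{P^X}$. Then for every $s\in(0,1]$, $$\mathrm E_\Phi\, D(W_{P^A\circ\Phi^{-1}}\|W_{P^X})\le\frac{v^s\,e^{-sH_{1+s}(P^A)}\,e^{\psi(s|W,P^X)}}{s}$$ and $$\mathrm E_\Phi\, e^{s\underline D(W_{P^A\circ\Phi^{-1}}\|W_{P^X})}\le\mathrm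 E_\Phi\, e^{\underline\psi^*(s|W_{P^A\circ\Phi^{-1}}\|W_{P^X})}\le 1+e^{-sH_{1+s}(P^A)}\,e^{\underline\psi^*(s|W,P^X)}.$$ -/

import Mathlib

open MeasureTheory ProbabilityTheory
open scoped ENNReal Kronecker ComplexOrder

noncomputable section

namespace QResolvability

variable {𝒜 𝒳 n : Type*}

/-- A quantum state (density matrix) on the finite-dimensional Hilbert space with orthonormal
basis indexed by `n`. -/
def IsState [Fintype n] (ρ : Matrix n n ℂ) : Prop :=
  ρ.PosSemidef ∧ ρ.trace = 1

/-- The power `A ^ r` of a positive semidefinite matrix, through its spectral decomposition.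
Since `0 ^ r = 0` for real `r ≠ 0`, a negative power of a singular matrix is the generalized
inverse power, that is, the power taken on the support. -/
def mpow [Fintype n] [DecidableEq n] (A : Matrix n n ℂ) (r : ℝ) : Matrix n n ℂ :=
  cfc (fun x : ℝ => x ^ r) A

/-- The logarithm of a positive semidefinite matrix, taken on its support
(as `Real.log 0 = 0`). -/
def mlog [Fintype n] [DecidableEq n] (A : Matrix n n ℂ) : Matrix n n ℂ :=
  cfc Real.log A

/-- For positive semidefinite matrices: the support of `ρ` is contained in that of `σ`,
that is, the kernel of `σ` is contained in that of `ρ`. -/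
def SuppLE [Fintype n] (ρ σ : Matrix n n ℂ) : Prop :=
  ∀ u : n → ℂ, σ.mulVec u = 0 → ρ.mulVec u = 0

/-- The matrix `σ^{-1/2} ρ σ^{-1/2}`. -/
def sandwich [Fintype n] [DecidableEq n] (ρ σ : Matrix n n ℂ) : Matrix n n ℂ :=
  mpow σ (-(1 / 2)) * ρ * mpow σ (-(1 / 2))

open Classical in
/-- Quantum relative entropy `D(ρ‖σ) = Tr ρ (log ρ - log σ)`, equal to `+∞` when the support
of `ρ` is not contained in that of `σ`. -/
def relEnt [Fintype n] [DecidableEq n] (ρ σ : Matrix n n ℂ) : EReal :=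
  if SuppLE ρ σ then (((ρ * (mlog ρ - mlog σ)).trace.re : ℝ) : EReal) else ⊤

open Classical in
/-- The second relative entropy `Tr ρ log (σ^{-1/2} ρ σ^{-1/2})`. It is `+∞` when the support
of `ρ` is not contained in that of `σ`. Otherwise it is `-∞` when `ρ` has positive weight on the
kernel of `σ^{-1/2} ρ σ^{-1/2}` (where the logarithm is `-∞`). -/
def relEntLow [Fintype n] [DecidableEq n] (ρ σ : Matrix n n ℂ) : EReal :=
  if SuppLE ρ σ then
    if SuppLE ρ (sandwich ρ σ) then (((ρ * mlog (sandwich ρ σ)).trace.re : ℝ) : EReal) else ⊥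
  else ⊤

open Classical in
/-- `ψ(s|ρ‖σ) = log Tr ρ^{1+s} σ^{-s}`, equal to `+∞` when the support of `ρ` is not contained in
that of `σ`. -/
def psi [Fintype n] [DecidableEq n] (s : ℝ) (ρ σ : Matrix n n ℂ) : EReal :=
  if SuppLE ρ σ then
    ENNReal.log (ENNReal.ofReal (mpow ρ (1 + s) * mpow σ (-s)).trace.re)
  else ⊤

open Classical in
/-- `ψ*(s|ρ‖σ) = log Tr ρ (σ^{-1/2} ρ σ^{-1/2})^s`, equal to `+∞` when the support of `ρ` is not
contained in that of `σ`. -/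
def psiLow [Fintype n] [DecidableEq n] (s : ℝ) (ρ σ : Matrix n n ℂ) : EReal :=
  if SuppLE ρ σ then
    ENNReal.log (ENNReal.ofReal (ρ * mpow (sandwich ρ σ) s).trace.re)
  else ⊤

/-- The reduced state on the first system of a bipartite system. -/
def marginalA [Fintype n] (ρ : Matrix (𝒳 × n) (𝒳 × n) ℂ) : Matrix 𝒳 𝒳 ℂ :=
  fun x y => ∑ i, ρ (x, i) (y, i)

/-- The reduced state on the second system of a bipartite system. -/
def marginalE [Fintype 𝒳] (ρ : Matrix (𝒳 × n) (𝒳 × n) ℂ) : Matrix n n ℂ :=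
  fun i j => ∑ x, ρ (x, i) (x, j)

/-- The output state `W_p = ∑ₓ p(x) Wₓ` of the classical-quantum channel `W` for the input
distribution `p`. -/
def output [Fintype 𝒳] (W : 𝒳 → Matrix n n ℂ) (p : PMF 𝒳) : Matrix n n ℂ :=
  ∑ x, ((p x).toReal : ℂ) • W x

/-- The classical-quantum state `ρ[W,p] = ∑ₓ p(x) |x⟩⟨x| ⊗ Wₓ`. -/
def cqState [Fintype 𝒳] [DecidableEq 𝒳] (W : 𝒳 → Matrix n n ℂ) (p : PMF 𝒳) :
    Matrix (𝒳 × n) (𝒳 × n) ℂ :=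
  ∑ x, ((p x).toReal : ℂ) • (Matrix.single x x (1 : ℂ) ⊗ₖ W x)

/-- `ψ(s|W,p) = ψ(s|ρ[W,p] ‖ ρ[W,p]_A ⊗ ρ[W,p]_E)`. -/
def psiChannel [Fintype 𝒳] [DecidableEq 𝒳] [Fintype n] [DecidableEq n]
    (s : ℝ) (W : 𝒳 → Matrix n n ℂ) (p : PMF 𝒳) : EReal :=
  psi s (cqState W p) (marginalA (cqState W p) ⊗ₖ marginalE (cqState W p))

/-- `ψ*(s|W,p) = ψ*(s|ρ[W,p] ‖ ρ[W,p]_A ⊗ ρ[W,p]_E)`. -/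
def psiLowChannel [Fintype 𝒳] [DecidableEq 𝒳] [Fintype n] [DecidableEq n]
    (s : ℝ) (W : 𝒳 → Matrix n n ℂ) (p : PMF 𝒳) : EReal :=
  psiLow s (cqState W p) (marginalA (cqState W p) ⊗ₖ marginalE (cqState W p))

/-- The Rényi entropy `H_{1+s}(P) = -(1/s) log ∑ₐ P(a)^{1+s}`. -/
def renyi [Fintype 𝒜] (s : ℝ) (P : PMF 𝒜) : ℝ :=
  (-1 / s) * Real.log (∑ a, (P a).toReal ^ (1 + s))

/-- The number of (distinct) eigenvalues of a matrix. -/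
def numEigenvalues [Fintype n] [DecidableEq n] (A : Matrix n n ℂ) : ℕ :=
  (spectrum ℂ A).ncard

end QResolvability

end

/-! Write σ for the output state of `PX`, and ρ_Φ = ∑ₐ P(a) W_{Φ(a)} for the output of the random
codebook. Both averages reduce to ∑ₐ P(a) E Tr W_{Φ(a)} f(ρ_Φ), where f is operator concave: a
regularized logarithm, or the power s ≤ 1 of the sandwich with σ^{-1/2}. Condition on Φ(a) = x. By
pairwise independence the conditional mean of ρ_Φ is P(a) W_x + (1 - P(a)) σ, so Jensen's inequality
brings the expectation inside f (`sum_concave_codebook_le`). What is left is to bound Tr W f(c W +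
(1 - c) σ) for one state W and c = P(a).

For the logarithm (`exists_trace_mul_mlog_sub_mlog_le`), W and σ need not commute. The pinching
inequality W ≤ v E(W) and operator monotonicity of log replace the argument by a matrix commuting
with σ. The scalar bound log(1 + x) ≤ x^s / s then applies in a common eigenbasis, and convexity of
x^{1+s} removes the pinching from the result. For the power (`trace_mul_mpow_sandwich_le`) no
pinching is needed: the sandwich of σ by itself is at most 1, and x ↦ x^s is operator monotone and
subadditive.

Averaging over a turns P(a) · c^s into P(a)^{1+s}, the Rényi term, and averaging over x gives the
trace in e^ψ because the classical-quantum state is block diagonal. The comparison between the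
second relative entropy and ψ* holds for each codebook separately, by weighted AM-GM in an
eigenbasis of the sandwich (`exp_mul_relEntLow_le`). -/

noncomputable section

namespace QResolvability

open Matrix

/-! ### Matrices in an orthonormal eigenbasis, and transition probabilities between two bases. -/

section Diagonalization

variable {n : Type*} [Fintype n] [DecidableEq n]

/-- The matrix with real eigenvalues `a` in the orthonormal basis formed by the columns of `U`. -/
def conjDiag (U : unitaryGroup n ℂ) : (n → ℝ) →ₐ[ℝ] Matrix n n ℂ where
  toFun a := (U : Matrix n n ℂ) * diagonal (fun i => (a i : ℂ)) * star (U : Matrix n n ℂ)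
  map_one' := by simp
  map_zero' := by simp [← Pi.zero_def]
  map_add' a b := by
    simp only [Pi.add_apply, Complex.ofReal_add, ← diagonal_add, mul_add, add_mul]
  map_mul' a b := by
    have h : star (U : Matrix n n ℂ) * (U : Matrix n n ℂ) = 1 := Unitary.coe_star_mul_self U
    calc _ = (U : Matrix n n ℂ) * (diagonal (fun i => (a i : ℂ)) * diagonal (fun i => (b i : ℂ)))
          * star (U : Matrix n n ℂ) := by simp [diagonal_mul_diagonal]
      _ = (U : Matrix n n ℂ) * (diagonal (fun i => (a i : ℂ)) *
          (star (U : Matrix n n ℂ) * (U : Matrix n n ℂ)) * diagonal (fun i => (b i : ℂ)))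
          * star (U : Matrix n n ℂ) := by rw [h, mul_one]
      _ = _ := by simp only [mul_assoc]
  commutes' r := by
    have : diagonal (fun i => ((algebraMap ℝ (n → ℝ) r i : ℝ) : ℂ))
        = algebraMap ℝ (Matrix n n ℂ) r := by
      ext i j; simp [algebraMap_matrix_apply, diagonal_apply]
    rw [this, ← Algebra.commutes, mul_assoc, Unitary.mul_star_self_of_mem U.2, mul_one]

theorem conjDiag_apply (U : unitaryGroup n ℂ) (a : n → ℝ) :
    conjDiag U a
      = (U : Matrix n n ℂ) * diagonal (fun i => (a i : ℂ)) * star (U : Matrix n n ℂ) := rfl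

theorem conjDiag_isHermitian (U : unitaryGroup n ℂ) (a : n → ℝ) : (conjDiag U a).IsHermitian := by
  rw [IsHermitian, conjDiag_apply, star_eq_conjTranspose, conjTranspose_mul, conjTranspose_mul,
    conjTranspose_conjTranspose, diagonal_conjTranspose, mul_assoc]
  congr 3
  ext i; simp

theorem exists_polynomial_eval_eq (s : Finset ℝ) (f : ℝ → ℝ) :
    ∃ q : Polynomial ℝ, ∀ x ∈ s, q.eval x = f x := by
  refine ⟨Lagrange.interpolate s id f, fun x hx => ?_⟩
  exact Lagrange.eval_interpolate_at_node (v := id) f (Set.injOn_id _) hx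

/-- The functional calculus acts on the eigenvalues, in any orthonormal eigenbasis. -/
theorem cfc_conjDiag (f : ℝ → ℝ) (U : unitaryGroup n ℂ) (a : n → ℝ) :
    cfc f (conjDiag U a) = conjDiag U (fun i => f (a i)) := by
  have hA : IsSelfAdjoint (conjDiag U a) := conjDiag_isHermitian U a
  have hfin : (spectrum ℝ (conjDiag U a)).Finite := by
    rw [(conjDiag_isHermitian U a).spectrum_real_eq_range_eigenvalues]
    exact Set.finite_range _
  -- Interpolating on the spectrum together with the values of `a` avoids proving that the two sets
  -- agree. A polynomial commutes with the algebra homomorphism `conjDiag U`.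
  obtain ⟨q, hq⟩ := exists_polynomial_eval_eq (hfin.toFinset ∪ Finset.univ.image a) f
  have h1 : cfc f (conjDiag U a) = cfc (fun x => q.eval x) (conjDiag U a) :=
    cfc_congr fun x hx => (hq x (by simp [hx])).symm
  rw [h1, cfc_polynomial q _ hA, Polynomial.aeval_algHom_apply]
  congr 1
  ext i
  rw [← hq (a i) (by simp)]
  simp

theorem mpow_conjDiag (U : unitaryGroup n ℂ) (a : n → ℝ) (r : ℝ) :
    mpow (conjDiag U a) r = conjDiag U (fun i => a i ^ r) := cfc_conjDiag _ U a

theorem mlog_conjDiag (U : unitaryGroup n ℂ) (a : n → ℝ) :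
    mlog (conjDiag U a) = conjDiag U (fun i => Real.log (a i)) := cfc_conjDiag _ U a

theorem exists_eq_conjDiag {A : Matrix n n ℂ} (hA : A.IsHermitian) :
    ∃ U a, A = conjDiag U a :=
  ⟨hA.eigenvectorUnitary, hA.eigenvalues, hA.spectral_theorem⟩

/-- The diagonal entries of `A` in the orthonormal basis formed by the columns of `U`. -/
def diagEntry (U : unitaryGroup n ℂ) (A : Matrix n n ℂ) (i : n) : ℝ :=
  (star (U : Matrix n n ℂ) * A * (U : Matrix n n ℂ)) i i |>.re

theorem diagEntry_conjDiag_self (U : unitaryGroup n ℂ) (a : n → ℝ) (i : n) :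
    diagEntry U (conjDiag U a) i = a i := by
  have h : star (U : Matrix n n ℂ) * (U : Matrix n n ℂ) = 1 := Unitary.coe_star_mul_self U
  have : star (U : Matrix n n ℂ) * conjDiag U a * (U : Matrix n n ℂ)
      = diagonal (fun i => (a i : ℂ)) := by
    rw [conjDiag_apply]
    calc _ = (star (U : Matrix n n ℂ) * (U : Matrix n n ℂ)) * diagonal (fun i => (a i : ℂ)) *
          (star (U : Matrix n n ℂ) * (U : Matrix n n ℂ)) := by simp only [mul_assoc]
      _ = _ := by rw [h, mul_one, one_mul]
  simp [diagEntry, this]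

theorem diagEntry_nonneg (U : unitaryGroup n ℂ) {A : Matrix n n ℂ} (hA : A.PosSemidef) (i : n) :
    0 ≤ diagEntry U A i := by
  have h := (hA.conjTranspose_mul_mul_same (U : Matrix n n ℂ)).diag_nonneg (i := i)
  exact (Complex.le_def.1 h).1

theorem trace_mul_conjDiag (ρ : Matrix n n ℂ) (U : unitaryGroup n ℂ) (a : n → ℝ) :
    (ρ * conjDiag U a).trace.re = ∑ i, diagEntry U ρ i * a i := by
  have : (ρ * conjDiag U a).trace
      = (star (U : Matrix n n ℂ) * ρ * (U : Matrix n n ℂ) * diagonal (fun i => (a i : ℂ))).trace := by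
    rw [conjDiag_apply, ← mul_assoc, Matrix.trace_mul_comm]
    simp only [mul_assoc]
  rw [this, Matrix.trace, Complex.re_sum]
  simp [diagEntry]

theorem sum_diagEntry (U : unitaryGroup n ℂ) (A : Matrix n n ℂ) :
    ∑ i, diagEntry U A i = A.trace.re := by
  have := trace_mul_conjDiag A U 1
  simpa using this.symm

/-- The transition probabilities between two orthonormal bases. -/
def overlap (U V : unitaryGroup n ℂ) (i j : n) : ℝ :=
  Complex.normSq ((star (U : Matrix n n ℂ) * (V : Matrix n n ℂ)) i j)

theorem overlap_nonneg (U V : unitaryGroup n ℂ) (i j : n) : 0 ≤ overlap U V i j :=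
  Complex.normSq_nonneg _

/-- Reading one matrix in the eigenbasis of another averages its eigenvalues with doubly stochastic
weights; this is the source of the Jensen and Klein inequalities below. -/
theorem diagEntry_conjDiag (U V : unitaryGroup n ℂ) (b : n → ℝ) (i : n) :
    diagEntry U (conjDiag V b) i = ∑ j, overlap U V i j * b j := by
  have : star (U : Matrix n n ℂ) * conjDiag V b * (U : Matrix n n ℂ)
      = (star (U : Matrix n n ℂ) * (V : Matrix n n ℂ)) * diagonal (fun i => (b i : ℂ)) *
        star (star (U : Matrix n n ℂ) * (V : Matrix n n ℂ)) := by
    rw [conjDiag_apply, star_mul, star_star]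
    simp only [mul_assoc]
  rw [diagEntry, this, Matrix.mul_apply, Complex.re_sum]
  refine Finset.sum_congr rfl fun j _ => ?_
  rw [mul_diagonal, star_apply, overlap, mul_right_comm, Complex.star_def, Complex.mul_conj,
    ← Complex.ofReal_mul, Complex.ofReal_re]

theorem sum_overlap_right (U V : unitaryGroup n ℂ) (i : n) : ∑ j, overlap U V i j = 1 := by
  -- The identity is diagonal in both bases, so its diagonal entry 1 is the row sum.
  have h := diagEntry_conjDiag U V 1 i
  rw [map_one, ← map_one (conjDiag U), diagEntry_conjDiag_self] at h
  simpa using h.symm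

theorem overlap_comm (U V : unitaryGroup n ℂ) (i j : n) : overlap U V i j = overlap V U j i := by
  have : star (V : Matrix n n ℂ) * (U : Matrix n n ℂ)
      = star (star (U : Matrix n n ℂ) * (V : Matrix n n ℂ)) := by rw [star_mul, star_star]
  rw [overlap, overlap, this, star_apply, Complex.star_def, Complex.normSq_conj]

theorem sum_overlap_left (U V : unitaryGroup n ℂ) (j : n) : ∑ i, overlap U V i j = 1 := by
  simp_rw [overlap_comm U V, sum_overlap_right]

theorem conjDiag_posSemidef (U : unitaryGroup n ℂ) {a : n → ℝ} (ha : ∀ i, 0 ≤ a i) :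
    (conjDiag U a).PosSemidef := by
  have h : (diagonal (fun i => (a i : ℂ))).PosSemidef :=
    PosSemidef.diagonal fun i => Complex.zero_le_real.2 (ha i)
  exact h.mul_mul_conjTranspose_same (U : Matrix n n ℂ)

theorem exists_eq_conjDiag_of_posSemidef {A : Matrix n n ℂ} (hA : A.PosSemidef) :
    ∃ U a, A = conjDiag U a ∧ ∀ i, 0 ≤ a i :=
  ⟨hA.1.eigenvectorUnitary, hA.1.eigenvalues, hA.1.spectral_theorem, hA.eigenvalues_nonneg⟩

theorem trace_mul_nonneg {A B : Matrix n n ℂ} (hA : A.PosSemidef) (hB : B.PosSemidef) :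
    0 ≤ (A * B).trace.re := by
  obtain ⟨U, b, rfl, hb⟩ := exists_eq_conjDiag_of_posSemidef hB
  rw [trace_mul_conjDiag]
  exact Finset.sum_nonneg fun i _ => mul_nonneg (diagEntry_nonneg U hA i) (hb i)

/-- Jensen's inequality for the diagonal entries of a function of a matrix. -/
theorem map_diagEntry_le {f : ℝ → ℝ} (hf : ConvexOn ℝ (Set.Ici 0) f) (U : unitaryGroup n ℂ)
    {A : Matrix n n ℂ} (hA : A.PosSemidef) (i : n) :
    f (diagEntry U A i) ≤ diagEntry U (cfc f A) i := by
  obtain ⟨V, a, rfl, ha⟩ := exists_eq_conjDiag_of_posSemidef hA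
  rw [cfc_conjDiag, diagEntry_conjDiag, diagEntry_conjDiag]
  simpa using hf.map_sum_le (t := Finset.univ) (w := overlap U V i) (p := a)
    (fun j _ => overlap_nonneg U V i j) (sum_overlap_right U V i) (fun j _ => ha j)

theorem conjDiag_mulVec_col (U : unitaryGroup n ℂ) (a : n → ℝ) (i : n) :
    conjDiag U a *ᵥ (fun k => (U : Matrix n n ℂ) k i)
      = (a i : ℂ) • (fun k => (U : Matrix n n ℂ) k i) := by
  have h : star (U : Matrix n n ℂ) * (U : Matrix n n ℂ) = 1 := Unitary.coe_star_mul_self U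
  have h2 : conjDiag U a * (U : Matrix n n ℂ)
      = (U : Matrix n n ℂ) * diagonal (fun i => (a i : ℂ)) := by
    rw [conjDiag_apply, mul_assoc, h, mul_one]
  ext k
  have := congrFun (congrFun h2 k) i
  rw [mul_diagonal] at this
  simpa [Matrix.mul_apply, mulVec, dotProduct, mul_comm] using this

/-- The `i`-th column of `U` lies in the kernel. This makes the conventions log 0 = 0 and 0^r = 0
harmless: `ρ` puts no weight where they are used. -/
theorem diagEntry_eq_zero_of_suppLE {ρ : Matrix n n ℂ} {U : unitaryGroup n ℂ} {a : n → ℝ}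
    (h : SuppLE ρ (conjDiag U a)) {i : n} (hi : a i = 0) : diagEntry U ρ i = 0 := by
  have h1 : ρ *ᵥ (fun k => (U : Matrix n n ℂ) k i) = 0 := by
    apply h
    rw [conjDiag_mulVec_col, hi]; simp
  rw [diagEntry, mul_assoc, Matrix.mul_apply]
  have : ∀ k, (ρ * (U : Matrix n n ℂ)) k i = 0 := fun k => congrFun h1 k
  simp [this]

end Diagonalization

/-! ### Simultaneous diagonalization and the pinching map. -/

section Pinching

variable {n : Type*} [Fintype n] [DecidableEq n]

/-- Commuting Hermitian matrices have a common orthonormal eigenbasis. -/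
theorem exists_eq_conjDiag_of_commute {A B : Matrix n n ℂ} (hA : A.IsHermitian)
    (hB : B.IsHermitian) (hAB : Commute A B) :
    ∃ U a b, A = conjDiag U a ∧ B = conjDiag U b := by
  have hS := isSymmetric_toEuclideanLin_iff.2 hA
  have hT := isSymmetric_toEuclideanLin_iff.2 hB
  have hST : Commute (toEuclideanLin A) (toEuclideanLin B) := by
    ext v : 1
    simp only [Module.End.mul_apply, toLpLin_apply, mulVec_mulVec, hAB.eq]
  have hV := hS.directSum_isInternal_of_commute hT hST
  let V : ℂ × ℂ → Submodule ℂ (EuclideanSpace ℂ n) := fun i =>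
    Module.End.eigenspace (toEuclideanLin A) i.2 ⊓ Module.End.eigenspace (toEuclideanLin B) i.1
  -- The joint eigenspaces are indexed by all of ℂ × ℂ. Only finitely many are nonzero, and the
  -- adapted orthonormal basis needs a finite index.
  let _ : Fintype {i // V i ≠ ⊥} := hV.submodule_iSupIndep.fintypeNeBotOfFiniteDimensional
  have hV' : DirectSum.IsInternal fun i : {i // V i ≠ ⊥} => V i :=
    DirectSum.isInternal_ne_bot_iff.2 hV
  have hO : OrthogonalFamily ℂ (fun i : {i // V i ≠ ⊥} => V i) fun i => (V i).subtypeₗᵢ :=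
    (LinearMap.IsSymmetric.orthogonalFamily_eigenspace_inf_eigenspace hS hT).comp
      Subtype.val_injective
  let b := (hV'.subordinateOrthonormalBasis (finrank_euclideanSpace (𝕜 := ℂ) (ι := n)) hO).reindex
    (Fintype.equivFin n).symm
  have hb : ∀ i, ∃ p : ℂ × ℂ, b i ∈ V p := fun i => by
    have h := hV'.subordinateOrthonormalBasis_subordinate
      (finrank_euclideanSpace (𝕜 := ℂ) (ι := n)) (Fintype.equivFin n i) hO
    simp only [b, OrthonormalBasis.reindex_apply]
    exact ⟨_, h⟩
  choose p hp using hb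
  let U : Matrix n n ℂ := of fun k i => b i k
  have hU : U ∈ unitaryGroup n ℂ := by
    rw [mem_unitaryGroup_iff']
    ext i j
    have := orthonormal_iff_ite.1 b.orthonormal i j
    rw [Matrix.one_apply, ← this, PiLp.inner_apply, Matrix.mul_apply]
    simp [U, star_apply, mul_comm]
  have key : ∀ (C : Matrix n n ℂ), C.IsHermitian → ∀ c : n → ℂ,
      (∀ i, toEuclideanLin C (b i) = c i • b i) →
        C = conjDiag ⟨U, hU⟩ fun i => (c i).re := by
    intro C hC c hc
    have h1 : C * U = U * diagonal c := by
      ext k i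
      have := congrArg (fun v : EuclideanSpace ℂ n => v k) (hc i)
      rw [mul_diagonal]
      simpa [toLpLin_apply, Matrix.mul_apply, mulVec, dotProduct, U, mul_comm] using this
    have h2 : star U * C * U = diagonal c := by
      rw [mul_assoc, h1, ← mul_assoc, mem_unitaryGroup_iff'.1 hU, one_mul]
    have h3 : (diagonal c).IsHermitian := by
      rw [← h2]
      exact isHermitian_conjTranspose_mul_mul U hC
    have h4 : (fun i => ((c i).re : ℂ)) = c := by
      ext i
      have := congrFun (congrFun h3 i) i
      simp only [conjTranspose_apply, diagonal_apply_eq] at this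
      exact Complex.conj_eq_iff_re.1 this
    rw [conjDiag_apply, h4, ← h1, mul_assoc, mem_unitaryGroup_iff.1 hU, mul_one]
  refine ⟨⟨U, hU⟩, fun i => (p i).2.re, fun i => (p i).1.re, key A hA _ fun i => ?_,
    key B hB _ fun i => ?_⟩
  · exact Module.End.mem_eigenspace_iff.1 (hp i).1
  · exact Module.End.mem_eigenspace_iff.1 (hp i).2

/-- The set of eigenvalues of a matrix given in diagonal form. -/
theorem numEigenvalues_conjDiag (U : unitaryGroup n ℂ) (d : n → ℝ) :
    numEigenvalues (conjDiag U d) = (Finset.univ.image d).card := by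
  have h : spectrum ℂ (conjDiag U d) = Complex.ofReal '' (Finset.univ.image d : Finset ℝ) := by
    have : conjDiag U d = (U : Matrix n n ℂ) * diagonal (fun i => (d i : ℂ)) *
      (star U : unitaryGroup n ℂ) := rfl
    rw [this, Unitary.coe_star, Unitary.spectrum_star_right_conjugate, spectrum_diagonal]
    ext x; simp
  rw [numEigenvalues, h, Set.ncard_image_of_injective _ Complex.ofReal_injective,
    Set.ncard_coe_finset]

/-- The pinching of `A` by the spectral projections of `conjDiag U d`. -/
def pinch (U : unitaryGroup n ℂ) (d : n → ℝ) (A : Matrix n n ℂ) : Matrix n n ℂ :=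
  ∑ l ∈ Finset.univ.image d, conjDiag U (fun i => if d i = l then 1 else 0) * A *
    conjDiag U (fun i => if d i = l then 1 else 0)

theorem pinch_posSemidef (U : unitaryGroup n ℂ) (d : n → ℝ) {A : Matrix n n ℂ}
    (hA : A.PosSemidef) : (pinch U d A).PosSemidef := by
  refine posSemidef_sum _ fun l _ => ?_
  have := hA.mul_mul_conjTranspose_same (conjDiag U (fun i => if d i = l then 1 else 0))
  rwa [(conjDiag_isHermitian U _).eq] at this

theorem sum_conjDiag_indicator (U : unitaryGroup n ℂ) (d : n → ℝ) :
    ∑ l ∈ Finset.univ.image d, conjDiag U (fun i => if d i = l then 1 else 0) = 1 := by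
  rw [← map_sum, ← map_one (conjDiag U)]
  congr 1
  ext i
  simp

/-- Multiplying a summand P_l A P_l by σ on either side only scales it by the eigenvalue l. -/
theorem pinch_commute (U : unitaryGroup n ℂ) (d : n → ℝ) (A : Matrix n n ℂ) :
    Commute (pinch U d A) (conjDiag U d) := by
  refine Commute.sum_left _ _ _ fun l _ => ?_
  have h : (fun i => if d i = l then (1 : ℝ) else 0) * d
      = l • fun i => if d i = l then (1 : ℝ) else 0 := by
    ext i
    by_cases h : d i = l <;> simp [h]
  have h1 : conjDiag U (fun i => if d i = l then 1 else 0) * conjDiag U d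
      = l • conjDiag U (fun i => if d i = l then 1 else 0) := by
    rw [← map_mul, h, map_smul]
  have h2 : conjDiag U d * conjDiag U (fun i => if d i = l then 1 else 0)
      = l • conjDiag U (fun i => if d i = l then 1 else 0) := by
    rw [← map_mul, mul_comm, h, map_smul]
  rw [Commute, SemiconjBy, mul_assoc, h1, ← mul_assoc, ← mul_assoc, h2]
  simp only [smul_mul_assoc, mul_smul_comm]

/-- The pinching inequality `A ≤ v • pinch A`. -/
theorem pinching_inequality (U : unitaryGroup n ℂ) (d : n → ℝ) {A : Matrix n n ℂ}
    (hA : A.PosSemidef) :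
    (((Finset.univ.image d).card : ℝ) • pinch U d A - A).PosSemidef := by
  set s := Finset.univ.image d
  set P : ℝ → Matrix n n ℂ := fun l => conjDiag U (fun i => if d i = l then 1 else 0)
  have hP : ∀ l, (P l).IsHermitian := fun l => conjDiag_isHermitian U _
  have h1 : ∑ l ∈ s, P l = 1 := sum_conjDiag_indicator U d
  have h2 : (∑ l ∈ s, ∑ k ∈ s, (P l - P k) * A * (P l - P k)).PosSemidef := by
    -- Since the projections sum to 1, expanding this positive double sum gives v·pinch(A) twice
    -- from the diagonal terms and -A twice from the cross terms.
    refine posSemidef_sum _ fun l _ => posSemidef_sum _ fun k _ => ?_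
    have := hA.mul_mul_conjTranspose_same (P l - P k)
    rwa [((hP l).sub (hP k)).eq] at this
  have h3 : ∑ l ∈ s, ∑ k ∈ s, (P l - P k) * A * (P l - P k)
      = (2 : ℝ) • ((s.card : ℝ) • pinch U d A - A) := by
    have e1 : ∀ l k, (P l - P k) * A * (P l - P k)
        = P l * A * P l - P l * A * P k - P k * A * P l + P k * A * P k := by
      intro l k; noncomm_ring
    simp only [e1, Finset.sum_add_distrib, Finset.sum_sub_distrib, ← Finset.mul_sum,
      ← Finset.sum_mul, h1, Finset.sum_const]
    have : pinch U d A = ∑ l ∈ s, P l * A * P l := rfl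
    simp only [mul_smul_comm, ← Finset.smul_sum, ← this, one_mul, mul_one,
      ← Nat.cast_smul_eq_nsmul ℝ]
    module
  rw [h3] at h2
  have := h2.smul (show (0 : ℝ) ≤ 1 / 2 by norm_num)
  rwa [smul_smul, show (1 / 2 : ℝ) * 2 = 1 by norm_num, one_smul] at this

theorem diagEntry_conjDiag_mul_mul (U : unitaryGroup n ℂ) (e : n → ℝ) (A : Matrix n n ℂ) (i : n) :
    diagEntry U (conjDiag U e * A * conjDiag U e) i = e i ^ 2 * diagEntry U A i := by
  have h : star (U : Matrix n n ℂ) * (U : Matrix n n ℂ) = 1 := mem_unitaryGroup_iff'.1 U.2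
  have : star (U : Matrix n n ℂ) * (conjDiag U e * A * conjDiag U e) * (U : Matrix n n ℂ)
      = diagonal (fun i => (e i : ℂ)) * (star (U : Matrix n n ℂ) * A * (U : Matrix n n ℂ)) *
        diagonal (fun i => (e i : ℂ)) := by
    rw [conjDiag_apply]
    calc _ = (star (U : Matrix n n ℂ) * (U : Matrix n n ℂ)) * diagonal (fun i => (e i : ℂ)) *
          (star (U : Matrix n n ℂ) * A * (U : Matrix n n ℂ)) * diagonal (fun i => (e i : ℂ)) *
          (star (U : Matrix n n ℂ) * (U : Matrix n n ℂ)) := by simp only [mul_assoc]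
      _ = _ := by rw [h, mul_one, one_mul]
  rw [diagEntry, this, mul_diagonal, diagonal_mul, mul_right_comm, ← Complex.ofReal_mul,
    Complex.re_ofReal_mul, sq, diagEntry]

/-- Pinching does not change the diagonal in an eigenbasis of the pinching matrix. -/
theorem diagEntry_pinch {U V : unitaryGroup n ℂ} {d e : n → ℝ} (h : conjDiag U d = conjDiag V e)
    (A : Matrix n n ℂ) (i : n) : diagEntry V (pinch U d A) i = diagEntry V A i := by
  -- Spectral projections are functions of the matrix alone, so either eigenbasis describes them.
  have hP : ∀ l, conjDiag U (fun i => if d i = l then 1 else 0)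
      = conjDiag V (fun i => if e i = l then 1 else 0) := fun l => by
    rw [← cfc_conjDiag (fun x => if x = l then 1 else 0), h, cfc_conjDiag]
  have hsum : ∀ (s : Finset ℝ) (f : ℝ → Matrix n n ℂ),
      diagEntry V (∑ l ∈ s, f l) i = ∑ l ∈ s, diagEntry V (f l) i := fun s f => by
    simp only [diagEntry, Finset.mul_sum, Finset.sum_mul, Matrix.sum_apply, Complex.re_sum]
  have h1 := congrArg (diagEntry V · i) (sum_conjDiag_indicator U d)
  simp only [hP, hsum, ← map_one (conjDiag V), diagEntry_conjDiag_self, Pi.one_apply] at h1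
  simp only [pinch, hP, hsum, diagEntry_conjDiag_mul_mul, ← Finset.sum_mul, ite_pow, one_pow,
    ne_eq, OfNat.ofNat_ne_zero, not_false_eq_true, zero_pow, h1, one_mul]

end Pinching

/-! ### Operator monotonicity and concavity, and trace estimates for one pair of matrices. -/

section SingleLetter

open scoped Matrix.Norms.L2Operator MatrixOrder

variable {n : Type*} [Fintype n] [DecidableEq n]

theorem isHermitian_cfc (f : ℝ → ℝ) (A : Matrix n n ℂ) : (cfc f A).IsHermitian :=
  cfc_predicate f A

theorem sandwich_posSemidef {ρ : Matrix n n ℂ} (hρ : ρ.PosSemidef) (σ : Matrix n n ℂ) :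
    (sandwich ρ σ).PosSemidef := by
  have h := hρ.mul_mul_conjTranspose_same (mpow σ (-(1 / 2)))
  rwa [mpow, (isHermitian_cfc _ σ).eq] at h

theorem mpow_posSemidef {A : Matrix n n ℂ} (hA : A.PosSemidef) (r : ℝ) :
    (mpow A r).PosSemidef := by
  obtain ⟨U, a, rfl, ha⟩ := exists_eq_conjDiag_of_posSemidef hA
  rw [mpow_conjDiag]
  exact conjDiag_posSemidef U fun i => Real.rpow_nonneg (ha i) r

theorem trace_mul_mono {ρ A B : Matrix n n ℂ} (hρ : ρ.PosSemidef) (h : A ≤ B) :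
    (ρ * A).trace.re ≤ (ρ * B).trace.re := by
  have := trace_mul_nonneg hρ (Matrix.le_iff.1 h)
  rw [mul_sub, trace_sub, Complex.sub_re] at this
  linarith

theorem mlog_le_mlog {A B : Matrix n n ℂ} (hA : A.PosDef) (h : A ≤ B) : mlog A ≤ mlog B :=
  CFC.log_le_log h (isStrictlyPositive_iff_posDef.2 hA)

theorem mpow_le_mpow {A B : Matrix n n ℂ} (hA : A.PosSemidef) (h : A ≤ B) {s : ℝ}
    (hs0 : 0 ≤ s) (hs1 : s ≤ 1) : mpow A s ≤ mpow B s := by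
  have h' : A ^ s ≤ B ^ s := CFC.rpow_le_rpow ⟨hs0, hs1⟩ h
  rwa [CFC.rpow_eq_cfc_real hA.nonneg, CFC.rpow_eq_cfc_real (hA.nonneg.trans h)] at h'

theorem posDef_add_smul_one {n : Type*} [DecidableEq n] {A : Matrix n n ℂ} (hA : A.PosSemidef) {ε : ℝ} (hε : 0 < ε) :
    (A + ε • (1 : Matrix n n ℂ)).PosDef :=
  PosDef.posSemidef_add hA (PosDef.one.smul hε)

theorem convex_posSemidef {n : Type*} : Convex ℝ {A : Matrix n n ℂ | A.PosSemidef} :=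
  fun _ hA _ hB _ _ ha hb _ => (hA.smul ha).add (hB.smul hb)

/-- Operator concavity of log, tested against `ρ`. The shift by ε keeps the argument positive
definite, since with log 0 = 0 concavity fails at singular matrices; the constant matrix `L` drops
out of the comparison because the weights sum to 1. -/
theorem concaveOn_trace_mlog {ρ : Matrix n n ℂ} (hρ : ρ.PosSemidef) (L : Matrix n n ℂ) {ε : ℝ}
    (hε : 0 < ε) : ConcaveOn ℝ {A : Matrix n n ℂ | A.PosSemidef}
      fun A => (ρ * (mlog (A + ε • (1 : Matrix n n ℂ)) - L)).trace.re := by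
  refine ⟨convex_posSemidef, fun A hA B hB a b ha hb hab => ?_⟩
  have h := (CFC.concaveOn_log (A := Matrix n n ℂ)).2
    (isStrictlyPositive_iff_posDef.2 (posDef_add_smul_one hA hε))
    (isStrictlyPositive_iff_posDef.2 (posDef_add_smul_one hB hε)) ha hb hab
  have e : a • (A + ε • (1 : Matrix n n ℂ)) + b • (B + ε • (1 : Matrix n n ℂ))
      = a • A + b • B + ε • 1 := by
    have : ε • (1 : Matrix n n ℂ) = (a + b) • ε • 1 := by rw [hab, one_smul]
    conv_rhs => rw [this]
    module
  rw [e] at h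
  have h2 := trace_mul_mono hρ h
  simp only [mul_add, mul_sub, mul_smul_comm, trace_add, trace_sub, trace_smul, Complex.add_re,
    Complex.sub_re, Complex.smul_re, smul_eq_mul] at h2 ⊢
  have hL : (ρ * L).trace.re = (a + b) * (ρ * L).trace.re := by rw [hab, one_mul]
  change _ ≤ (ρ * mlog _).trace.re at h2
  change a * (ρ * mlog _).trace.re + b * (ρ * mlog _).trace.re ≤ _ at h2
  linarith

theorem sandwich_add_smul (A B σ : Matrix n n ℂ) (a b : ℝ) :
    sandwich (a • A + b • B) σ = a • sandwich A σ + b • sandwich B σ := by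
  simp only [sandwich, mul_add, add_mul, mul_smul_comm, smul_mul_assoc]

/-- The sandwich is linear in its first argument, and x^s with 0 ≤ s ≤ 1 is operator concave on the
whole positive cone, so no regularization is needed here. -/
theorem concaveOn_trace_mpow_sandwich {ρ : Matrix n n ℂ} (hρ : ρ.PosSemidef) (σ : Matrix n n ℂ)
    {s : ℝ} (hs0 : 0 ≤ s) (hs1 : s ≤ 1) : ConcaveOn ℝ {A : Matrix n n ℂ | A.PosSemidef}
      fun A => (ρ * mpow (sandwich A σ) s).trace.re := by
  refine ⟨convex_posSemidef, fun A hA B hB a b ha hb hab => ?_⟩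
  have hA' := sandwich_posSemidef hA σ
  have hB' := sandwich_posSemidef hB σ
  have h : a • sandwich A σ ^ s + b • sandwich B σ ^ s
      ≤ (a • sandwich A σ + b • sandwich B σ) ^ s :=
    (CFC.concaveOn_rpow (A := Matrix n n ℂ) (p := s) ⟨hs0, hs1⟩).2 hA'.nonneg hB'.nonneg ha hb hab
  rw [CFC.rpow_eq_cfc_real hA'.nonneg, CFC.rpow_eq_cfc_real hB'.nonneg,
    CFC.rpow_eq_cfc_real ((hA'.smul ha).add (hB'.smul hb)).nonneg] at h
  beta_reduce
  rw [sandwich_add_smul]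
  have h2 := trace_mul_mono hρ h
  simp only [mul_add, mul_smul_comm, trace_add, trace_smul, Complex.add_re,
    Complex.smul_re, smul_eq_mul] at h2 ⊢
  exact h2

/-- Subadditivity of the power gives (1 + x)^s ≤ 1 + x^s, and log(1 + y) ≤ y finishes. -/
theorem log_one_add_le_rpow_div {x s : ℝ} (hx : 0 ≤ x) (hs0 : 0 < s) (hs1 : s ≤ 1) :
    Real.log (1 + x) ≤ x ^ s / s := by
  rw [le_div_iff₀ hs0, mul_comm, ← Real.log_rpow (by linarith)]
  calc Real.log ((1 + x) ^ s) ≤ Real.log (1 ^ s + x ^ s) :=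
        Real.log_le_log (by positivity) (Real.rpow_add_le_add_rpow zero_le_one hx hs0.le hs1)
    _ ≤ x ^ s := by
        have := Real.log_le_sub_one_of_pos (show 0 < 1 ^ s + x ^ s by positivity)
        rw [Real.one_rpow] at this ⊢
        linarith

/-- This is the estimate for one common eigenvector: `w` and `e` are the eigenvalues of the pinched
W and of σ, and `t` is v·c. After division by `e`, the inequality 1 + x + y ≤ (1 + x)(1 + y)
separates the regularization from the main term. -/
theorem mul_log_sub_log_le {w e t ε s : ℝ} (hw : 0 ≤ w) (he : 0 ≤ e) (hwe : e = 0 → w = 0)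
    (ht : 0 ≤ t) (hε : 0 < ε) (hs0 : 0 < s) (hs1 : s ≤ 1) :
    w * (Real.log (t * w + e + ε) - Real.log e)
      ≤ t ^ s / s * (w ^ (1 + s) * e ^ (-s)) + ε * (w / e) := by
  rcases hw.eq_or_lt with rfl | hw'
  · simp [Real.zero_rpow (show 1 + s ≠ 0 by linarith)]
  have he' : 0 < e := he.lt_of_ne fun h => hw'.ne' (hwe h.symm)
  set x := t * w / e with hx
  set y := ε / e with hy
  have hx0 : 0 ≤ x := by positivity
  have hy0 : 0 ≤ y := by positivity
  have h1 : Real.log (t * w + e + ε) - Real.log e ≤ x ^ s / s + y := by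
    rw [← Real.log_div (by positivity) he'.ne']
    calc Real.log ((t * w + e + ε) / e) = Real.log (1 + x + y) := by
          congr 1; rw [hx, hy]; field_simp; ring
      _ ≤ Real.log ((1 + x) * (1 + y)) := Real.log_le_log (by positivity) (by nlinarith)
      _ = Real.log (1 + x) + Real.log (1 + y) := Real.log_mul (by positivity) (by positivity)
      _ ≤ x ^ s / s + y := by
          have := Real.log_le_sub_one_of_pos (show 0 < 1 + y by positivity)
          have := log_one_add_le_rpow_div hx0 hs0 hs1
          linarith
  calc _ ≤ w * (x ^ s / s + y) := mul_le_mul_of_nonneg_left h1 hw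
    _ = _ := by
      rw [hx, hy, Real.div_rpow (by positivity) he, Real.mul_rpow ht hw, Real.rpow_add hw',
        Real.rpow_one, Real.rpow_neg he]
      ring

/-- Bound on `Tr W (log (c W + (1 - c) σ + ε) - log σ)`, uniform in `c`, by pinching. -/
theorem exists_trace_mul_mlog_sub_mlog_le {W σ : Matrix n n ℂ} (hW : W.PosSemidef)
    (hσ : σ.PosSemidef) (h : SuppLE W σ) {s : ℝ} (hs0 : 0 < s) (hs1 : s ≤ 1) :
    ∃ K : ℝ, ∀ c : ℝ, 0 ≤ c → ∀ ε : ℝ, 0 < ε → c ≤ 1 →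
      (W * (mlog (c • W + (1 - c) • σ + ε • (1 : Matrix n n ℂ)) - mlog σ)).trace.re
        ≤ ((numEigenvalues σ : ℝ) * c) ^ s / s * (mpow W (1 + s) * mpow σ (-s)).trace.re
          + ε * K := by
  obtain ⟨U, d, rfl, -⟩ := exists_eq_conjDiag_of_posSemidef hσ
  have hE := pinch_posSemidef U d hW
  -- V diagonalizes both the pinched W and σ. The eigenvalues `w` are also the diagonal entries of W
  -- itself, so the trace against W sees only `w`.
  obtain ⟨V, w, e, hVE, hVσ⟩ := exists_eq_conjDiag_of_commute hE.1 hσ.1 (pinch_commute U d W)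
  have hw : ∀ i, w i = diagEntry V W i := fun i => by
    rw [← diagEntry_pinch hVσ, hVE, diagEntry_conjDiag_self]
  have hw0 : ∀ i, 0 ≤ w i := fun i => hw i ▸ diagEntry_nonneg V hW i
  have he0 : ∀ i, 0 ≤ e i := fun i => by
    rw [← diagEntry_conjDiag_self V e i, ← hVσ]; exact diagEntry_nonneg V hσ i
  have hwe : ∀ i, e i = 0 → w i = 0 := fun i hi => by
    rw [hw]; exact diagEntry_eq_zero_of_suppLE (hVσ ▸ h) hi
  refine ⟨∑ i, w i / e i, fun c hc ε hε hc1 => ?_⟩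
  set v : ℝ := (numEigenvalues (conjDiag U d) : ℝ) with hv
  have hv0 : 0 ≤ v := Nat.cast_nonneg _
  -- The pinching inequality is used for c W, and (1 - c) σ is enlarged to σ.
  have hle : c • W + (1 - c) • conjDiag U d + ε • (1 : Matrix n n ℂ)
      ≤ conjDiag V (fun i => v * c * w i + e i + ε) := by
    have e1 : conjDiag V (fun i => v * c * w i + e i + ε)
        = (v * c) • pinch U d W + conjDiag U d + ε • 1 := by
      rw [hVE, hVσ, ← map_one (conjDiag V), ← map_smul, ← map_smul, ← map_add, ← map_add]
      congr 1
      ext i; simp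
    have e2 : (v * c) • pinch U d W + conjDiag U d + ε • (1 : Matrix n n ℂ)
        - (c • W + (1 - c) • conjDiag U d + ε • (1 : Matrix n n ℂ))
        = c • (v • pinch U d W - W) + c • conjDiag U d := by module
    rw [Matrix.le_iff, e1, e2]
    have h1 := ((pinching_inequality U d hW).smul hc).add (hσ.smul hc)
    rw [← numEigenvalues_conjDiag U d, ← hv] at h1
    exact h1
  have hpd : (c • W + (1 - c) • conjDiag U d + ε • (1 : Matrix n n ℂ)).PosDef :=
    posDef_add_smul_one ((hW.smul hc).add (hσ.smul (sub_nonneg.2 hc1))) hε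
  have h1 := trace_mul_mono hW (mlog_le_mlog hpd hle)
  -- Jensen for the convex function x^{1+s} on diagonal entries replaces the pinched W by W.
  have h2 : ∑ i, w i ^ (1 + s) * e i ^ (-s)
      ≤ (mpow W (1 + s) * mpow (conjDiag U d) (-s)).trace.re := by
    rw [hVσ, mpow_conjDiag, trace_mul_conjDiag]
    refine Finset.sum_le_sum fun i _ => mul_le_mul_of_nonneg_right ?_ (Real.rpow_nonneg (he0 i) _)
    rw [hw]
    exact map_diagEntry_le (convexOn_rpow (by linarith)) V hW i
  rw [mul_sub, trace_sub, Complex.sub_re]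
  calc _ ≤ ∑ i, w i * (Real.log (v * c * w i + e i + ε) - Real.log (e i)) := by
        simp only [mul_sub, Finset.sum_sub_distrib]
        refine sub_le_sub (h1.trans_eq ?_) (le_of_eq ?_)
        · rw [mlog_conjDiag, trace_mul_conjDiag]; simp only [hw]
        · rw [hVσ, mlog_conjDiag, trace_mul_conjDiag]; simp only [hw]
    _ ≤ ∑ i, ((v * c) ^ s / s * (w i ^ (1 + s) * e i ^ (-s)) + ε * (w i / e i)) :=
        Finset.sum_le_sum fun i _ => mul_log_sub_log_le (hw0 i) (he0 i) (hwe i)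
          (mul_nonneg hv0 hc) hε hs0 hs1
    _ = (v * c) ^ s / s * ∑ i, w i ^ (1 + s) * e i ^ (-s) + ε * ∑ i, w i / e i := by
        rw [Finset.sum_add_distrib, Finset.mul_sum, Finset.mul_sum]
    _ ≤ _ := by
        gcongr

/-- Bound on `Tr W (σ^{-1/2} (c W + (1 - c) σ) σ^{-1/2}) ^ s`. -/
theorem trace_mul_mpow_sandwich_le {W σ : Matrix n n ℂ} (hW : IsState W)
    (hσ : σ.PosSemidef) {s : ℝ} (hs0 : 0 < s) (hs1 : s ≤ 1) {c : ℝ} (hc : 0 ≤ c) (hc1 : c ≤ 1) :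
    (W * mpow (sandwich (c • W + (1 - c) • σ) σ) s).trace.re
      ≤ 1 + c ^ s * (W * mpow (sandwich W σ) s).trace.re := by
  -- This matrix is the projection onto the support of σ, hence not 1 when σ is singular.
  have hP : sandwich σ σ ≤ 1 := by
    obtain ⟨U, d, rfl, hd⟩ := exists_eq_conjDiag_of_posSemidef hσ
    rw [Matrix.le_iff, sandwich, mpow_conjDiag, ← map_mul, ← map_mul, ← map_one (conjDiag U),
      ← map_sub]
    refine conjDiag_posSemidef U fun i => ?_
    simp only [Pi.sub_apply, Pi.one_apply, Pi.mul_apply, sub_nonneg]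
    rcases (hd i).eq_or_lt with h | h
    · simp [← h]
    · rw [mul_right_comm, ← Real.rpow_add h]
      norm_num
      rw [Real.rpow_neg_one, inv_mul_cancel₀ h.ne']
  obtain ⟨U, a, hS, ha⟩ := exists_eq_conjDiag_of_posSemidef (sandwich_posSemidef hW.1 σ)
  have hle : sandwich (c • W + (1 - c) • σ) σ ≤ conjDiag U (fun i => c * a i + 1) := by
    have e1 : conjDiag U (fun i => c * a i + 1) = c • sandwich W σ + 1 := by
      rw [hS, ← map_one (conjDiag U), ← map_smul, ← map_add]
      congr 1
    have e2 : c • sandwich W σ + 1 - (c • sandwich W σ + (1 - c) • sandwich σ σ)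
        = (1 - c) • (1 - sandwich σ σ) + c • (1 : Matrix n n ℂ) := by module
    rw [sandwich_add_smul, e1, Matrix.le_iff, e2]
    have h1 := ((Matrix.le_iff.1 hP).smul (sub_nonneg.2 hc1)).add
      (PosSemidef.one.smul hc : (c • (1 : Matrix n n ℂ)).PosSemidef)
    exact h1
  have hps := sandwich_posSemidef ((hW.1.smul hc).add (hσ.smul (sub_nonneg.2 hc1))) σ
  refine (trace_mul_mono hW.1 (mpow_le_mpow hps hle hs0.le hs1)).trans ?_
  have hq : ∑ i, diagEntry U W i = 1 := by rw [sum_diagEntry, hW.2]; rfl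
  rw [hS, mpow_conjDiag, mpow_conjDiag, trace_mul_conjDiag, trace_mul_conjDiag]
  have hterm : ∀ i, diagEntry U W i * (c * a i + 1) ^ s
      ≤ diagEntry U W i + c ^ s * (diagEntry U W i * a i ^ s) := fun i => by
    have h1 := Real.rpow_add_le_add_rpow (mul_nonneg hc (ha i)) zero_le_one hs0.le hs1
    rw [Real.one_rpow, Real.mul_rpow hc (ha i)] at h1
    have := mul_le_mul_of_nonneg_left h1 (diagEntry_nonneg U hW.1 i)
    linarith
  refine (Finset.sum_le_sum fun i _ => hterm i).trans_eq ?_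
  rw [Finset.sum_add_distrib, hq, Finset.mul_sum]

/-- From log y ≤ y - 1 at y = t / r; it is the scalar form of Klein's inequality. -/
theorem mul_log_sub_mul_log_ge {r t : ℝ} (hr : 0 ≤ r) (ht : 0 < t) :
    r - t ≤ r * Real.log r - r * Real.log t := by
  rcases hr.eq_or_lt with rfl | hr'
  · simp [ht.le]
  have h := Real.log_le_sub_one_of_pos (show 0 < t / r by positivity)
  rw [Real.log_div ht.ne' hr'.ne'] at h
  have := mul_le_mul_of_nonneg_left h hr
  have e : r * (t / r - 1) = t - r := by field_simp
  linarith

/-- Klein's inequality. -/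
theorem trace_mul_mlog_sub_mlog_nonneg {ρ σ : Matrix n n ℂ} (hρ : ρ.PosSemidef)
    (hσ : σ.PosSemidef) (htr : ρ.trace = σ.trace) (h : SuppLE ρ σ) :
    0 ≤ (ρ * (mlog ρ - mlog σ)).trace.re := by
  obtain ⟨U, r, rfl, hr⟩ := exists_eq_conjDiag_of_posSemidef hρ
  obtain ⟨V, t, rfl, ht⟩ := exists_eq_conjDiag_of_posSemidef hσ
  -- Under the support condition a sum of nonnegative terms vanishes, so each term does; this covers
  -- the eigenvalues of σ where the scalar bound is unavailable.
  have hz : ∀ i j, t j = 0 → overlap V U j i * r i = 0 := fun i j hj => by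
    have h1 := diagEntry_eq_zero_of_suppLE h hj
    rw [diagEntry_conjDiag] at h1
    exact (Finset.sum_eq_zero_iff_of_nonneg
      fun i _ => mul_nonneg (overlap_nonneg V U j i) (hr i)).1 h1 i (Finset.mem_univ i)
  have hterm : ∀ j i, overlap V U j i * r i - overlap V U j i * t j
      ≤ overlap V U j i * (r i * Real.log (r i)) - overlap V U j i * r i * Real.log (t j) := by
    intro j i
    rcases (ht j).eq_or_lt with h0 | h0
    · have := hz i j h0.symm
      rw [← mul_assoc, this, ← h0]; simp
    · have := mul_le_mul_of_nonneg_left (mul_log_sub_mul_log_ge (hr i) h0)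
        (overlap_nonneg V U j i)
      linarith
  have hsum := Finset.sum_le_sum fun j (_ : j ∈ Finset.univ) =>
    Finset.sum_le_sum fun i (_ : i ∈ Finset.univ) => hterm j i
  have htr' : ∑ i, r i = ∑ j, t j := by
    have h1 := sum_diagEntry U (conjDiag U r)
    have h2 := sum_diagEntry V (conjDiag V t)
    simp only [diagEntry_conjDiag_self] at h1 h2
    rw [h1, h2, htr]
  have e1 : ∀ f : n → ℝ, ∑ j, ∑ i, overlap V U j i * f i = ∑ i, f i := fun f => by
    rw [Finset.sum_comm]
    simp only [← Finset.sum_mul, sum_overlap_left, one_mul]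
  have e2 : ∑ j, ∑ i, overlap V U j i * t j = ∑ j, t j := by
    simp only [← Finset.sum_mul, sum_overlap_right, one_mul]
  simp only [Finset.sum_sub_distrib] at hsum
  rw [e1 r, e2, e1 fun i => r i * Real.log (r i), htr', sub_self] at hsum
  rw [mul_sub, trace_sub, Complex.sub_re, mlog_conjDiag, mlog_conjDiag, trace_mul_conjDiag,
    trace_mul_conjDiag]
  simp only [diagEntry_conjDiag_self]
  simpa only [diagEntry_conjDiag, Finset.sum_mul] using hsum

/-- Zero eigenvalues of `ρ` carry no weight, and log is increasing at the others. This brings in the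
ε needed for concavity. -/
theorem trace_mul_mlog_le_add {ρ : Matrix n n ℂ} (hρ : ρ.PosSemidef) {ε : ℝ} (hε : 0 < ε) :
    (ρ * mlog ρ).trace.re ≤ (ρ * mlog (ρ + ε • (1 : Matrix n n ℂ))).trace.re := by
  obtain ⟨U, r, rfl, hr⟩ := exists_eq_conjDiag_of_posSemidef hρ
  have e1 : conjDiag U r + ε • (1 : Matrix n n ℂ) = conjDiag U (fun i => r i + ε) := by
    rw [← map_one (conjDiag U), ← map_smul, ← map_add]
    congr 1
    ext i; simp
  rw [e1, mlog_conjDiag, mlog_conjDiag, trace_mul_conjDiag, trace_mul_conjDiag]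
  refine Finset.sum_le_sum fun i _ => ?_
  rw [diagEntry_conjDiag_self]
  rcases (hr i).eq_or_lt with h | h
  · simp [← h]
  · exact mul_le_mul_of_nonneg_left (Real.log_le_log h (by linarith)) (hr i)

/-- Jensen's inequality: `s` times the second relative entropy is at most `ψ*(s)`. -/
theorem exp_mul_relEntLow_le {ρ : Matrix n n ℂ} (hρ : IsState ρ) (σ : Matrix n n ℂ) {s : ℝ}
    (hs0 : 0 < s) :
    EReal.exp ((s : EReal) * relEntLow ρ σ) ≤ EReal.exp (psiLow s ρ σ) := by
  unfold relEntLow psiLow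
  split_ifs with h1 h2
  · obtain ⟨U, a, hS, ha⟩ := exists_eq_conjDiag_of_posSemidef (sandwich_posSemidef hρ.1 σ)
    rw [hS] at h2
    have hz : ∀ i, a i = 0 → diagEntry U ρ i = 0 := fun i => diagEntry_eq_zero_of_suppLE h2
    have hq0 : ∀ i, 0 ≤ diagEntry U ρ i := diagEntry_nonneg U hρ.1
    have hq : ∑ i, diagEntry U ρ i = 1 := by rw [sum_diagEntry, hρ.2]; rfl
    rw [ENNReal.exp_log, ← EReal.coe_mul, EReal.exp_coe, hS, mlog_conjDiag, mpow_conjDiag,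
      trace_mul_conjDiag, trace_mul_conjDiag]
    refine ENNReal.ofReal_le_ofReal ?_
    -- Weighted AM-GM: the exponential of ∑ s qᵢ log aᵢ is the geometric mean of the aᵢ^s. Where aᵢ
    -- = 0 the weight vanishes and both factors are 1.
    refine le_trans (le_of_eq ?_) (Real.geom_mean_le_arith_mean_weighted Finset.univ
      (diagEntry U ρ) (fun i => a i ^ s) (fun i _ => hq0 i) hq
      fun i _ => Real.rpow_nonneg (ha i) s)
    rw [Finset.mul_sum, Real.exp_sum]
    refine Finset.prod_congr rfl fun i _ => ?_
    rcases (ha i).eq_or_lt with h | h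
    · simp [hz i h.symm]
    · rw [← Real.rpow_mul h.le, Real.rpow_def_of_pos h]
      congr 1; ring
  · rw [EReal.coe_mul_bot_of_pos hs0, EReal.exp_bot]
    exact zero_le
  · exact le_top

end SingleLetter

/-! ### Output states as real linear combinations. -/

section Output

variable {𝒳 n : Type*} [Fintype 𝒳]

theorem output_eq_sum (W : 𝒳 → Matrix n n ℂ) (p : PMF 𝒳) :
    output W p = ∑ x, (p x).toReal • W x := by
  simp only [output, ← Complex.coe_smul]

theorem output_posSemidef [Fintype n] {W : 𝒳 → Matrix n n ℂ} (hW : ∀ x, IsState (W x)) (p : PMF 𝒳) :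
    (output W p).PosSemidef := by
  rw [output_eq_sum]
  exact posSemidef_sum _ fun x _ => (hW x).1.smul ENNReal.toReal_nonneg

end Output

/-! ### Block diagonal form of the classical-quantum state and its exponents. -/

section Block

variable {𝒳 n : Type*} [DecidableEq 𝒳]

/-- The block diagonal matrix `∑ₓ |x⟩⟨x| ⊗ Mₓ`. -/
def blockDiag (M : 𝒳 → Matrix n n ℂ) : Matrix (𝒳 × n) (𝒳 × n) ℂ :=
  fun p q => if p.1 = q.1 then M p.1 p.2 q.2 else 0

variable [Fintype 𝒳]

theorem cqState_eq_blockDiag (W : 𝒳 → Matrix n n ℂ) (p : PMF 𝒳) :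
    cqState W p = blockDiag fun x => (p x).toReal • W x := by
  ext ⟨x, i⟩ ⟨y, j⟩
  simp only [cqState, blockDiag, Matrix.sum_apply, Matrix.smul_apply, kroneckerMap_apply,
    smul_eq_mul, single_apply]
  by_cases h : x = y
  · subst h
    simp
  · rw [if_neg h]
    refine Finset.sum_eq_zero fun z _ => ?_
    rw [if_neg (by rintro ⟨rfl, rfl⟩; exact h rfl)]
    simp

theorem marginalE_cqState (W : 𝒳 → Matrix n n ℂ) (p : PMF 𝒳) :
    marginalE (cqState W p) = output W p := by
  rw [cqState_eq_blockDiag, output_eq_sum]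
  ext i j
  simp [marginalE, blockDiag, Matrix.sum_apply]

variable [Fintype n]

theorem blockDiag_mul (M N : 𝒳 → Matrix n n ℂ) :
    blockDiag M * blockDiag N = blockDiag fun x => M x * N x := by
  ext ⟨x, i⟩ ⟨y, j⟩
  simp only [blockDiag, Matrix.mul_apply, Fintype.sum_prod_type]
  by_cases h : x = y
  · subst h
    simp
  · rw [if_neg h]
    refine Finset.sum_eq_zero fun z _ => Finset.sum_eq_zero fun k _ => ?_
    by_cases h1 : x = z
    · rw [if_neg (h1 ▸ h : ¬ z = y), mul_zero]
    · rw [if_neg h1, zero_mul]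

theorem trace_blockDiag (M : 𝒳 → Matrix n n ℂ) : (blockDiag M).trace = ∑ x, (M x).trace := by
  simp [Matrix.trace, blockDiag, Fintype.sum_prod_type]

theorem marginalA_cqState {W : 𝒳 → Matrix n n ℂ} (hW : ∀ x, IsState (W x)) (p : PMF 𝒳) :
    marginalA (cqState W p) = diagonal fun x => ((p x).toReal : ℂ) := by
  rw [cqState_eq_blockDiag]
  ext x y
  by_cases h : x = y
  · subst h
    have : ∑ i, W x i i = 1 := (hW x).2
    simp [marginalA, blockDiag, ← Finset.mul_sum, this]
  · simp [marginalA, blockDiag, h]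

theorem marginalA_kronecker_marginalE {W : 𝒳 → Matrix n n ℂ} (hW : ∀ x, IsState (W x))
    (p : PMF 𝒳) :
    marginalA (cqState W p) ⊗ₖ marginalE (cqState W p)
      = blockDiag fun x => (p x).toReal • output W p := by
  rw [marginalA_cqState hW, marginalE_cqState]
  ext ⟨x, i⟩ ⟨y, j⟩
  by_cases h : x = y
  · subst h
    simp [blockDiag, kroneckerMap_apply]
  · simp [blockDiag, kroneckerMap_apply, h]

variable [DecidableEq n]

theorem blockDiag_mem_unitaryGroup (U : 𝒳 → unitaryGroup n ℂ) :
    blockDiag (fun x => (U x : Matrix n n ℂ)) ∈ unitaryGroup (𝒳 × n) ℂ := by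
  have hstar : star (blockDiag fun x => (U x : Matrix n n ℂ))
      = blockDiag fun x => star (U x : Matrix n n ℂ) := by
    ext ⟨x, i⟩ ⟨y, j⟩
    by_cases h : x = y
    · subst h; simp [blockDiag, star_apply]
    · simp [blockDiag, star_apply, h, Ne.symm h]
  rw [mem_unitaryGroup_iff, hstar, blockDiag_mul]
  ext ⟨x, i⟩ ⟨y, j⟩
  by_cases h : x = y
  · subst h
    have : (U x : Matrix n n ℂ) * star (U x : Matrix n n ℂ) = 1 := mem_unitaryGroup_iff.1 (U x).2
    simp [blockDiag, this, one_apply]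
  · simp [blockDiag, one_apply, h]

theorem blockDiag_conjDiag (U : 𝒳 → unitaryGroup n ℂ) (a : 𝒳 → n → ℝ) :
    blockDiag (fun x => conjDiag (U x) (a x))
      = conjDiag ⟨_, blockDiag_mem_unitaryGroup U⟩ fun p => a p.1 p.2 := by
  have h1 : diagonal (fun p : 𝒳 × n => ((a p.1 p.2 : ℝ) : ℂ))
      = blockDiag fun x => diagonal fun i => (a x i : ℂ) := by
    ext ⟨x, i⟩ ⟨y, j⟩
    by_cases h : x = y
    · subst h; simp [blockDiag, diagonal_apply]
    · simp [blockDiag, h]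
  have h2 : star (blockDiag fun x => (U x : Matrix n n ℂ))
      = blockDiag fun x => star (U x : Matrix n n ℂ) := by
    ext ⟨x, i⟩ ⟨y, j⟩
    by_cases h : x = y
    · subst h; simp [blockDiag, star_apply]
    · simp [blockDiag, star_apply, h, Ne.symm h]
  rw [conjDiag_apply, h1, h2, blockDiag_mul, blockDiag_mul]
  rfl

/-- Eigenbases chosen block by block assemble into an eigenbasis of the whole matrix. -/
theorem mpow_blockDiag {M : 𝒳 → Matrix n n ℂ} (hM : ∀ x, (M x).IsHermitian) (r : ℝ) :
    mpow (blockDiag M) r = blockDiag fun x => mpow (M x) r := by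
  choose U a h using fun x => exists_eq_conjDiag (hM x)
  obtain rfl : M = fun x => conjDiag (U x) (a x) := funext h
  rw [blockDiag_conjDiag]
  simp only [mpow_conjDiag]
  rw [blockDiag_conjDiag]

theorem mpow_smul {A : Matrix n n ℂ} (hA : A.PosSemidef) {c : ℝ} (hc : 0 ≤ c) (r : ℝ) :
    mpow (c • A) r = c ^ r • mpow A r := by
  obtain ⟨U, a, rfl, ha⟩ := exists_eq_conjDiag_of_posSemidef hA
  rw [← map_smul, mpow_conjDiag, mpow_conjDiag, ← map_smul]
  congr 1
  ext i
  simp [Real.mul_rpow hc (ha i)]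

/-- `e ^ ψ(s|W,p) = ∑ₓ p(x) Tr Wₓ^{1+s} W_p^{-s}`. -/
theorem le_exp_psiChannel {W : 𝒳 → Matrix n n ℂ} (hW : ∀ x, IsState (W x)) (p : PMF 𝒳) {s : ℝ}
    (hs0 : 0 < s) :
    ENNReal.ofReal (∑ x, (p x).toReal * (mpow (W x) (1 + s) * mpow (output W p) (-s)).trace.re)
      ≤ EReal.exp (psiChannel s W p) := by
  have hσ := output_posSemidef hW p
  have hp : ∀ x, 0 ≤ (p x).toReal := fun x => ENNReal.toReal_nonneg
  rw [psiChannel, psi]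
  split_ifs with h
  · rw [ENNReal.exp_log, marginalA_kronecker_marginalE hW, cqState_eq_blockDiag,
      mpow_blockDiag fun x => ((hW x).1.smul (hp x)).1, mpow_blockDiag fun x => (hσ.smul (hp x)).1,
      blockDiag_mul, trace_blockDiag, Complex.re_sum]
    refine ENNReal.ofReal_le_ofReal (le_of_eq (Finset.sum_congr rfl fun x _ => ?_))
    rw [mpow_smul (hW x).1 (hp x), mpow_smul hσ (hp x), smul_mul_smul_comm, trace_smul,
      Complex.smul_re, smul_eq_mul]
    congr 1
    -- The weights combine as p^{1+s} p^{-s} = p, also at p = 0 because 1 + s ≠ 0.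
    rcases (hp x).eq_or_lt with h0 | h0
    · rw [← h0, Real.zero_rpow (by linarith), zero_mul]
    · rw [← Real.rpow_add h0]; simp
  · exact le_top

/-- `e ^ ψ*(s|W,p) = ∑ₓ p(x) Tr Wₓ (W_p^{-1/2} Wₓ W_p^{-1/2}) ^ s`. -/
theorem le_exp_psiLowChannel {W : 𝒳 → Matrix n n ℂ} (hW : ∀ x, IsState (W x)) (p : PMF 𝒳)
    (s : ℝ) :
    ENNReal.ofReal (∑ x, (p x).toReal * (W x * mpow (sandwich (W x) (output W p)) s).trace.re)
      ≤ EReal.exp (psiLowChannel s W p) := by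
  have hσ := output_posSemidef hW p
  have hp : ∀ x, 0 ≤ (p x).toReal := fun x => ENNReal.toReal_nonneg
  rw [psiLowChannel, psiLow]
  split_ifs with h
  · have hS : ∀ x, (sandwich (W x) (output W p)).PosSemidef :=
      fun x => sandwich_posSemidef (hW x).1 _
    -- The factor p^{-1/2} p p^{-1/2} is 1 when p(x) > 0. For p(x) = 0 its value is immaterial, as
    -- the block is multiplied by p(x).
    set c : 𝒳 → ℝ := fun x =>
      (p x).toReal ^ (-(1 / 2) : ℝ) * (p x).toReal * (p x).toReal ^ (-(1 / 2) : ℝ) with hc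
    have hc0 : ∀ x, 0 ≤ c x := fun x => by have := hp x; positivity
    have e1 : sandwich (blockDiag fun x => (p x).toReal • W x)
        (blockDiag fun x => (p x).toReal • output W p)
        = blockDiag fun x => c x • sandwich (W x) (output W p) := by
      rw [sandwich, mpow_blockDiag fun x => (hσ.smul (hp x)).1, blockDiag_mul, blockDiag_mul]
      congr 1
      ext1 x
      rw [mpow_smul hσ (hp x), smul_mul_smul_comm, smul_mul_smul_comm, sandwich]
    rw [ENNReal.exp_log, marginalA_kronecker_marginalE hW, cqState_eq_blockDiag, e1,
      mpow_blockDiag fun x => ((hS x).smul (hc0 x)).1, blockDiag_mul, trace_blockDiag,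
      Complex.re_sum]
    refine ENNReal.ofReal_le_ofReal (le_of_eq (Finset.sum_congr rfl fun x _ => ?_))
    rw [mpow_smul (hS x) (hc0 x), smul_mul_smul_comm, trace_smul, Complex.smul_re, smul_eq_mul]
    congr 1
    rcases (hp x).eq_or_lt with h0 | h0
    · rw [← h0, zero_mul]
    · have : c x = 1 := by
        rw [hc]
        dsimp only
        rw [mul_right_comm, ← Real.rpow_add h0]
        norm_num
        rw [Real.rpow_neg_one, inv_mul_cancel₀ h0.ne']
      rw [this, Real.one_rpow, mul_one]
  · exact le_top

end Block

/-! ### Conditioning on one codeword, and Jensen's inequality over codebooks. -/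

section Averaging

variable {𝒜 𝒳 E : Type*} [Fintype 𝒜] [Fintype 𝒳] [DecidableEq 𝒳] [AddCommGroup E] [Module ℝ E]

/-- Under a pairwise independent law `q` of codebooks with marginal `p`, the average of the
codewords over the codebooks `φ` with `φ a = x`. -/
theorem sum_filter_smul_sum_smul [Fintype (𝒜 → 𝒳)] {q : (𝒜 → 𝒳) → ℝ} {p : 𝒳 → ℝ}
    (hmarg : ∀ a x, ∑ φ with φ a = x, q φ = p x)
    (hpair : ∀ a a', a ≠ a' → ∀ x x', ∑ φ with φ a = x ∧ φ a' = x', q φ = p x * p x')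
    {P : 𝒜 → ℝ} (hP : ∑ a, P a = 1) (W : 𝒳 → E) (a : 𝒜) (x : 𝒳) :
    ∑ φ with φ a = x, q φ • ∑ a', P a' • W (φ a')
      = p x • (P a • W x + (1 - P a) • ∑ y, p y • W y) := by
  classical
  -- Given φ(a) = x, the codeword at a is fixed, and by pairwise independence any other one averages
  -- to the output state.
  have h1 : ∀ a', ∑ φ with φ a = x, q φ • W (φ a')
      = p x • if a' = a then W x else ∑ y, p y • W y := by
    intro a'
    split_ifs with h
    · subst h
      rw [← hmarg a' x, Finset.sum_smul]
      refine Finset.sum_congr rfl fun φ hφ => ?_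
      rw [(Finset.mem_filter.1 hφ).2]
    · rw [← Finset.sum_fiberwise _ fun φ => φ a', Finset.smul_sum]
      refine Finset.sum_congr rfl fun y _ => ?_
      rw [Finset.filter_filter, smul_smul, ← hpair a a' (Ne.symm h) x y, Finset.sum_smul]
      refine Finset.sum_congr rfl fun φ hφ => ?_
      rw [(Finset.mem_filter.1 hφ).2.2]
  simp only [Finset.smul_sum]
  rw [Finset.sum_comm]
  simp only [smul_comm (q _) (P _), ← Finset.smul_sum, h1]
  simp only [smul_comm (P _) (p x), ← Finset.smul_sum]
  congr 1
  rw [← Finset.add_sum_erase _ _ (Finset.mem_univ a), if_pos rfl]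
  congr 1
  rw [← hP, ← Finset.add_sum_erase _ _ (Finset.mem_univ a), add_sub_cancel_left, Finset.sum_smul]
  refine Finset.sum_congr rfl fun b hb => ?_
  rw [if_neg (Finset.ne_of_mem_erase hb)]

/-- Jensen's inequality for a random codebook whose codewords are pairwise independent. -/
theorem sum_concave_codebook_le [Fintype (𝒜 → 𝒳)] {q : (𝒜 → 𝒳) → ℝ} {p : 𝒳 → ℝ}
    (hq : ∀ φ, 0 ≤ q φ) (hmarg : ∀ a x, ∑ φ with φ a = x, q φ = p x)
    (hpair : ∀ a a', a ≠ a' → ∀ x x', ∑ φ with φ a = x ∧ φ a' = x', q φ = p x * p x')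
    {P : 𝒜 → ℝ} (hP0 : ∀ a, 0 ≤ P a) (hP : ∑ a, P a = 1) {K : Set E} (W : 𝒳 → E)
    (hW : ∀ x, W x ∈ K) {F : 𝒳 → E → ℝ} (hF : ∀ x, ConcaveOn ℝ K (F x)) :
    ∑ φ, q φ * ∑ a, P a * F (φ a) (∑ a', P a' • W (φ a'))
      ≤ ∑ a, P a * ∑ x, p x * F x (P a • W x + (1 - P a) • ∑ y, p y • W y) := by
  have hp : ∀ a x, 0 ≤ p x := fun a x => hmarg a x ▸ Finset.sum_nonneg fun φ _ => hq φ
  have hK : ∀ φ : 𝒜 → 𝒳, ∑ a', P a' • W (φ a') ∈ K := fun φ => by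
    rcases isEmpty_or_nonempty 𝒜 with h | ⟨⟨a⟩⟩
    · simp at hP
    · exact (hF (φ a)).1.sum_mem (fun a _ => hP0 a) hP fun a _ => hW _
  have key : ∀ a x, ∑ φ with φ a = x, q φ * F x (∑ a', P a' • W (φ a'))
      ≤ p x * F x (P a • W x + (1 - P a) • ∑ y, p y • W y) := by
    intro a x
    rcases (hp a x).eq_or_lt with h0 | h0
    · have hz : ∀ φ ∈ Finset.univ.filter (fun φ : 𝒜 → 𝒳 => φ a = x), q φ = 0 :=
        (Finset.sum_eq_zero_iff_of_nonneg fun φ _ => hq φ).1 ((hmarg a x).trans h0.symm)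
      rw [← h0, zero_mul]
      exact (Finset.sum_eq_zero fun φ hφ => by rw [hz φ hφ, zero_mul]).le
    -- The weights q(φ)/p(x) are the conditional law of the codebook given φ(a) = x.
    · have h := (hF x).le_map_sum (t := Finset.univ.filter (fun φ : 𝒜 → 𝒳 => φ a = x))
        (w := fun φ => (p x)⁻¹ * q φ) (p := fun φ => ∑ a', P a' • W (φ a'))
        (fun φ _ => mul_nonneg (inv_nonneg.2 h0.le) (hq φ))
        (by rw [← Finset.mul_sum, hmarg, inv_mul_cancel₀ h0.ne']) (fun φ _ => hK φ)
      simp only [← smul_smul, ← Finset.smul_sum] at h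
      rw [sum_filter_smul_sum_smul hmarg hpair hP, smul_smul, inv_mul_cancel₀ h0.ne',
        one_smul] at h
      simp only [smul_eq_mul] at h
      rwa [inv_mul_le_iff₀ h0] at h
  calc _ = ∑ a, P a * ∑ φ, q φ * F (φ a) (∑ a', P a' • W (φ a')) := by
        simp only [Finset.mul_sum]
        rw [Finset.sum_comm]
        exact Finset.sum_congr rfl fun a _ => Finset.sum_congr rfl fun φ _ => by ring
    _ = ∑ a, P a * ∑ x, ∑ φ with φ a = x, q φ * F x (∑ a', P a' • W (φ a')) := by
        refine Finset.sum_congr rfl fun a _ => ?_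
        -- Splitting by the value at a fixes the functional F x within each group, as Jensen
        -- requires.
        rw [← Finset.sum_fiberwise _ fun φ : 𝒜 → 𝒳 => φ a]
        congr 1
        refine Finset.sum_congr rfl fun x _ => Finset.sum_congr rfl fun φ hφ => ?_
        rw [(Finset.mem_filter.1 hφ).2]
    _ ≤ _ := Finset.sum_le_sum fun a _ =>
        mul_le_mul_of_nonneg_left (Finset.sum_le_sum fun x _ => key a x) (hP0 a)

end Averaging

/-! ### The law of the random codebook on the finite set of maps. -/

section Law

variable {𝒜 𝒳 Ω : Type*} [Fintype 𝒜] [Fintype 𝒳] [MeasurableSpace 𝒳]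
  [MeasurableSingletonClass 𝒳] [MeasurableSpace Ω]

/-- The probability that the random map `Φ` is `φ`. -/
def codebookLaw (μ : Measure Ω) (Φ : 𝒜 → Ω → 𝒳) (φ : 𝒜 → 𝒳) : ℝ :=
  (μ.map fun ω a => Φ a ω).real {φ}

variable {μ : Measure Ω} [IsProbabilityMeasure μ] {Φ : 𝒜 → Ω → 𝒳}

theorem sum_filter_codebookLaw [Fintype (𝒜 → 𝒳)] (hΦ : ∀ a, Measurable (Φ a))
    (C : (𝒜 → 𝒳) → Prop) [DecidablePred C] :
    ∑ φ with C φ, codebookLaw μ Φ φ = μ.real {ω | C fun a => Φ a ω} := by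
  have hm : Measurable fun ω a => Φ a ω := measurable_pi_lambda _ hΦ
  have : IsProbabilityMeasure (μ.map fun ω a => Φ a ω) :=
    Measure.isProbabilityMeasure_map hm.aemeasurable
  simp only [codebookLaw]
  rw [sum_measureReal_singleton, map_measureReal_apply hm (Set.toFinite _).measurableSet]
  simp [Set.preimage]

theorem codebookLaw_marginal [DecidableEq 𝒳] [Fintype (𝒜 → 𝒳)] (hΦ : ∀ a, Measurable (Φ a)) {p : PMF 𝒳}
    (hlaw : ∀ a, μ.map (Φ a) = p.toMeasure) (a : 𝒜) (x : 𝒳) :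
    ∑ φ with φ a = x, codebookLaw μ Φ φ = (p x).toReal := by
  rw [sum_filter_codebookLaw hΦ]
  have h : μ.map (Φ a) {x} = p x := by
    rw [hlaw, PMF.toMeasure_apply_singleton _ _ (measurableSet_singleton x)]
  rw [← h, Measure.map_apply (hΦ a) (measurableSet_singleton x)]
  rfl

theorem codebookLaw_pair [DecidableEq 𝒳] [Fintype (𝒜 → 𝒳)] (hΦ : ∀ a, Measurable (Φ a)) {p : PMF 𝒳}
    (hlaw : ∀ a, μ.map (Φ a) = p.toMeasure) {a a' : 𝒜} (h : IndepFun (Φ a) (Φ a') μ)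
    (x x' : 𝒳) :
    ∑ φ with φ a = x ∧ φ a' = x', codebookLaw μ Φ φ = (p x).toReal * (p x').toReal := by
  rw [sum_filter_codebookLaw hΦ]
  have h1 : ∀ a x, μ (Φ a ⁻¹' {x}) = p x := fun a x => by
    rw [← Measure.map_apply (hΦ a) (measurableSet_singleton x), hlaw,
      PMF.toMeasure_apply_singleton _ _ (measurableSet_singleton x)]
  have h2 := h.measure_inter_preimage_eq_mul {x} {x'} (measurableSet_singleton x)
    (measurableSet_singleton x')
  rw [h1, h1] at h2
  rw [← ENNReal.toReal_mul, ← h2]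
  rfl

/-- The bounds are asked only for codebooks of positive probability: another codebook may use
letters outside the support of `PX`, where the divergences can be infinite. -/
theorem lintegral_codebook_le [Fintype (𝒜 → 𝒳)] (hΦ : ∀ a, Measurable (Φ a))
    {g : (𝒜 → 𝒳) → ℝ≥0∞} {r : (𝒜 → 𝒳) → ℝ}
    (hr : ∀ φ, codebookLaw μ Φ φ ≠ 0 → 0 ≤ r φ)
    (hg : ∀ φ, codebookLaw μ Φ φ ≠ 0 → g φ ≤ ENNReal.ofReal (r φ)) :
    ∫⁻ ω, g (fun a => Φ a ω) ∂μ ≤ ENNReal.ofReal (∑ φ, codebookLaw μ Φ φ * r φ) := by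
  have hm : Measurable fun ω a => Φ a ω := measurable_pi_lambda _ hΦ
  have : IsProbabilityMeasure (μ.map fun ω a => Φ a ω) :=
    Measure.isProbabilityMeasure_map hm.aemeasurable
  have hq : ∀ φ, 0 ≤ codebookLaw μ Φ φ := fun φ => ENNReal.toReal_nonneg
  rw [← lintegral_map (measurable_of_finite g) hm, lintegral_fintype,
    ENNReal.ofReal_sum_of_nonneg]
  · refine Finset.sum_le_sum fun φ _ => ?_
    have e : (μ.map fun ω a => Φ a ω) {φ} = ENNReal.ofReal (codebookLaw μ Φ φ) :=
      (ENNReal.ofReal_toReal (measure_ne_top _ _)).symm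
    rw [e, ENNReal.ofReal_mul (hq φ), mul_comm]
    by_cases h : codebookLaw μ Φ φ = 0
    · simp [h]
    · gcongr
      exact hg φ h
  · intro φ _
    by_cases h : codebookLaw μ Φ φ = 0
    · simp [h]
    · exact mul_nonneg (hq φ) (hr φ h)

end Law

/-! ### Images of distributions, supports of output states, and the Rényi entropy. -/

section Channel

variable {𝒜 𝒳 n : Type*} [Fintype 𝒜] [Fintype 𝒳]

theorem sum_pmf_toReal (p : PMF 𝒜) : ∑ a, (p a).toReal = 1 := by
  rw [← ENNReal.toReal_sum fun a _ => p.apply_ne_top a, ← tsum_fintype (L := .unconditional _),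
    p.tsum_coe, ENNReal.toReal_one]

theorem output_map (W : 𝒳 → Matrix n n ℂ) (p : PMF 𝒜) (φ : 𝒜 → 𝒳) :
    output W (p.map φ) = ∑ a, (p a).toReal • W (φ a) := by
  classical
  have h : ∀ x, ((p.map φ) x).toReal = ∑ a with φ a = x, (p a).toReal := fun x => by
    rw [PMF.map_apply, tsum_fintype, ENNReal.toReal_sum, Finset.sum_filter]
    · refine Finset.sum_congr rfl fun a _ => ?_
      by_cases hx : φ a = x
      · simp [hx]
      · simp [hx, Ne.symm hx]
    · intro a _
      split_ifs
      · exact p.apply_ne_top a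
      · simp
  rw [output_eq_sum, ← Finset.sum_fiberwise _ φ]
  refine Finset.sum_congr rfl fun x _ => ?_
  rw [h, Finset.sum_smul]
  refine Finset.sum_congr rfl fun a ha => ?_
  rw [(Finset.mem_filter.1 ha).2]

variable [Fintype n]

theorem output_isState {W : 𝒳 → Matrix n n ℂ} (hW : ∀ x, IsState (W x)) (p : PMF 𝒳) :
    IsState (output W p) := by
  refine ⟨output_posSemidef hW p, ?_⟩
  rw [output_eq_sum, trace_sum]
  simp only [trace_smul, (hW _).2, ← Finset.sum_smul, sum_pmf_toReal, one_smul]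

/-- For u in the kernel of the output state, ⟨u, W_p u⟩ = 0 is a sum of nonnegative terms p(y)⟨u,
W_y u⟩, and a positive matrix kills u once its quadratic form does. -/
theorem suppLE_output {W : 𝒳 → Matrix n n ℂ} (hW : ∀ x, IsState (W x)) {p : PMF 𝒳} {x : 𝒳}
    (hx : p x ≠ 0) : SuppLE (W x) (output W p) := by
  classical
  intro u hu
  have hp : 0 < (p x).toReal := ENNReal.toReal_pos hx (p.apply_ne_top x)
  rw [← (hW x).1.dotProduct_mulVec_zero_iff]
  have h0 : ∀ y, 0 ≤ (p y).toReal • (star u ⬝ᵥ W y *ᵥ u) := fun y =>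
    smul_nonneg ENNReal.toReal_nonneg ((hW y).1.dotProduct_mulVec_nonneg u)
  have h1 : ∑ y, (p y).toReal • (star u ⬝ᵥ W y *ᵥ u) = 0 := by
    rw [output_eq_sum] at hu
    have := congrArg (star u ⬝ᵥ ·) hu
    simpa [sum_mulVec, dotProduct_sum, smul_mulVec, dotProduct_smul] using this
  have h2 := (Finset.sum_eq_zero_iff_of_nonneg fun y _ => h0 y).1 h1 x (Finset.mem_univ x)
  exact (smul_eq_zero.1 h2).resolve_left hp.ne'

theorem suppLE_output_map {W : 𝒳 → Matrix n n ℂ} (p : PMF 𝒜) {φ : 𝒜 → 𝒳}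
    {σ : Matrix n n ℂ} (h : ∀ a, SuppLE (W (φ a)) σ) : SuppLE (output W (p.map φ)) σ := by
  intro u hu
  rw [output_map, sum_mulVec]
  exact Finset.sum_eq_zero fun a _ => by rw [smul_mulVec, h a u hu, smul_zero]

theorem trace_output_map_mul_re (W : 𝒳 → Matrix n n ℂ) (p : PMF 𝒜) (φ : 𝒜 → 𝒳)
    (A : Matrix n n ℂ) :
    (output W (p.map φ) * A).trace.re = ∑ a, (p a).toReal * (W (φ a) * A).trace.re := by
  rw [output_map, Finset.sum_mul, trace_sum, Complex.re_sum]
  simp only [smul_mul_assoc, trace_smul, Complex.smul_re, smul_eq_mul]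

theorem exp_neg_mul_renyi (P : PMF 𝒜) {s : ℝ} (hs : 0 < s) :
    Real.exp (-s * renyi s P) = ∑ a, (P a).toReal ^ (1 + s) := by
  have hpos : 0 < ∑ a, (P a).toReal ^ (1 + s) := by
    obtain ⟨a, ha⟩ := P.support_nonempty
    refine Finset.sum_pos' (fun a _ => Real.rpow_nonneg ENNReal.toReal_nonneg _)
      ⟨a, Finset.mem_univ a, Real.rpow_pos_of_pos (ENNReal.toReal_pos ?_ (P.apply_ne_top a)) _⟩
    exact (P.mem_support_iff a).1 ha
  rw [renyi, ← mul_assoc, show -s * (-1 / s) = 1 by field_simp, one_mul, Real.exp_log hpos]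

end Channel

/-! ### The two averaged bounds for pairwise independent codebooks. -/

section Main

variable {𝒜 𝒳 n : Type*} [Fintype 𝒜] [Fintype 𝒳] [DecidableEq 𝒳] [Fintype n] [DecidableEq n]
  [Fintype (𝒜 → 𝒳)]

/-- The average relative entropy of a codebook whose codewords are pairwise independent. -/
theorem sum_codebook_relEnt_le {W : 𝒳 → Matrix n n ℂ} (hW : ∀ x, IsState (W x))
    (PA : PMF 𝒜) (PX : PMF 𝒳) {q : (𝒜 → 𝒳) → ℝ} (hq : ∀ φ, 0 ≤ q φ)
    (hmarg : ∀ a x, ∑ φ with φ a = x, q φ = (PX x).toReal)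
    (hpair : ∀ a a', a ≠ a' → ∀ x x',
      ∑ φ with φ a = x ∧ φ a' = x', q φ = (PX x).toReal * (PX x').toReal)
    {s : ℝ} (hs0 : 0 < s) (hs1 : s ≤ 1) :
    ∑ φ, q φ * (output W (PA.map φ) *
        (mlog (output W (PA.map φ)) - mlog (output W PX))).trace.re
      ≤ (numEigenvalues (output W PX) : ℝ) ^ s * (∑ a, (PA a).toReal ^ (1 + s)) *
        (∑ x, (PX x).toReal * (mpow (W x) (1 + s) * mpow (output W PX) (-s)).trace.re) / s := by
  set σ := output W PX with hσ
  have hσp : σ.PosSemidef := output_posSemidef hW PX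
  set v : ℝ := (numEigenvalues σ : ℝ)
  have hv0 : 0 ≤ v := Nat.cast_nonneg _
  have hP0 : ∀ a, 0 ≤ (PA a).toReal := fun a => ENNReal.toReal_nonneg
  have hP1 : ∀ a, (PA a).toReal ≤ 1 := fun a =>
    ENNReal.toReal_mono ENNReal.one_ne_top (PA.coe_le_one a)
  -- The condition on x stands inside the existential so that a constant can be chosen for every x;
  -- letters of probability zero have weight zero below.
  have hbound : ∀ x, ∃ K : ℝ, PX x ≠ 0 → ∀ c : ℝ, 0 ≤ c → ∀ ε : ℝ, 0 < ε → c ≤ 1 →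
      (W x * (mlog (c • W x + (1 - c) • σ + ε • (1 : Matrix n n ℂ)) - mlog σ)).trace.re
        ≤ (v * c) ^ s / s * (mpow (W x) (1 + s) * mpow σ (-s)).trace.re + ε * K := fun x => by
    by_cases hx : PX x = 0
    · exact ⟨0, fun h => absurd hx h⟩
    · obtain ⟨K, hK⟩ := exists_trace_mul_mlog_sub_mlog_le (hW x).1 hσp (suppLE_output hW hx)
        hs0 hs1
      exact ⟨K, fun _ => hK⟩
  choose K hK using hbound
  set T : 𝒳 → ℝ := fun x => (mpow (W x) (1 + s) * mpow σ (-s)).trace.re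
  have hmain : ∀ ε : ℝ, 0 < ε → ∑ φ, q φ * (output W (PA.map φ) *
        (mlog (output W (PA.map φ)) - mlog σ)).trace.re
      ≤ v ^ s * (∑ a, (PA a).toReal ^ (1 + s)) * (∑ x, (PX x).toReal * T x) / s
        + ε * ∑ x, (PX x).toReal * K x := by
    intro ε hε
    calc _ ≤ ∑ φ, q φ * ∑ a, (PA a).toReal * (W (φ a) *
            (mlog (∑ a', (PA a').toReal • W (φ a') + ε • (1 : Matrix n n ℂ))
              - mlog σ)).trace.re := by
          refine Finset.sum_le_sum fun φ _ => mul_le_mul_of_nonneg_left ?_ (hq φ)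
          rw [← output_map, ← trace_output_map_mul_re, mul_sub, mul_sub, trace_sub, trace_sub,
            Complex.sub_re, Complex.sub_re]
          exact sub_le_sub_right (trace_mul_mlog_le_add (output_posSemidef hW _) hε) _
      _ ≤ ∑ a, (PA a).toReal * ∑ x, (PX x).toReal * (W x *
            (mlog ((PA a).toReal • W x + (1 - (PA a).toReal) • ∑ y, (PX y).toReal • W y
              + ε • (1 : Matrix n n ℂ)) - mlog σ)).trace.re :=
          sum_concave_codebook_le hq hmarg hpair hP0 (sum_pmf_toReal PA) W (fun x => (hW x).1)
            fun x => concaveOn_trace_mlog (hW x).1 (mlog σ) hε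
      _ ≤ ∑ a, (PA a).toReal * ∑ x, (PX x).toReal *
            ((v * (PA a).toReal) ^ s / s * T x + ε * K x) := by
          rw [← output_eq_sum, ← hσ]
          refine Finset.sum_le_sum fun a _ => mul_le_mul_of_nonneg_left
            (Finset.sum_le_sum fun x _ => ?_) (hP0 a)
          by_cases hx : PX x = 0
          · simp [hx]
          · exact mul_le_mul_of_nonneg_left (hK x hx _ (hP0 a) ε hε (hP1 a))
              ENNReal.toReal_nonneg
      _ = ∑ a, (v ^ s * (PA a).toReal ^ (1 + s) * (∑ x, (PX x).toReal * T x) / s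
            + (PA a).toReal * (ε * ∑ x, (PX x).toReal * K x)) := by
          refine Finset.sum_congr rfl fun a _ => ?_
          have e1 : (PA a).toReal * (PA a).toReal ^ s = (PA a).toReal ^ (1 + s) := by
            rw [Real.rpow_add_of_nonneg (hP0 a) zero_le_one hs0.le, Real.rpow_one]
          have e2 : ∑ x, (PX x).toReal * ((v * (PA a).toReal) ^ s / s * T x + ε * K x)
              = (v * (PA a).toReal) ^ s / s * (∑ x, (PX x).toReal * T x)
                + ε * ∑ x, (PX x).toReal * K x := by
            rw [Finset.mul_sum, Finset.mul_sum, ← Finset.sum_add_distrib]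
            exact Finset.sum_congr rfl fun x _ => by ring
          rw [e2, Real.mul_rpow hv0 (hP0 a), ← e1]
          ring
      _ = _ := by
          rw [Finset.sum_add_distrib, ← Finset.sum_mul, sum_pmf_toReal, one_mul,
            ← Finset.sum_div, ← Finset.sum_mul, ← Finset.mul_sum]
  -- The left side is free of ε, so the error term ε·C is removed by letting ε tend to 0; the choice
  -- δ/(|C| + 1) works for either sign of C and for C = 0.
  refine le_of_forall_pos_le_add fun δ hδ => ?_
  set C := ∑ x, (PX x).toReal * K x
  have h := hmain (δ / (|C| + 1)) (by positivity)
  have hC : δ / (|C| + 1) * C ≤ δ := by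
    rw [div_mul_eq_mul_div, div_le_iff₀ (by positivity)]
    exact mul_le_mul_of_nonneg_left ((le_abs_self C).trans (by linarith)) hδ.le
  linarith

/-- The average of `Tr ρ (σ^{-1/2} ρ σ^{-1/2}) ^ s` over a codebook whose codewords are pairwise
independent. -/
theorem sum_codebook_mpow_sandwich_le {W : 𝒳 → Matrix n n ℂ} (hW : ∀ x, IsState (W x))
    (PA : PMF 𝒜) (PX : PMF 𝒳) {q : (𝒜 → 𝒳) → ℝ} (hq : ∀ φ, 0 ≤ q φ)
    (hmarg : ∀ a x, ∑ φ with φ a = x, q φ = (PX x).toReal)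
    (hpair : ∀ a a', a ≠ a' → ∀ x x',
      ∑ φ with φ a = x ∧ φ a' = x', q φ = (PX x).toReal * (PX x').toReal)
    {s : ℝ} (hs0 : 0 < s) (hs1 : s ≤ 1) :
    ∑ φ, q φ * (output W (PA.map φ) *
        mpow (sandwich (output W (PA.map φ)) (output W PX)) s).trace.re
      ≤ 1 + (∑ a, (PA a).toReal ^ (1 + s)) *
        ∑ x, (PX x).toReal * (W x * mpow (sandwich (W x) (output W PX)) s).trace.re := by
  set σ := output W PX with hσ
  have hσp : σ.PosSemidef := output_posSemidef hW PX
  have hP0 : ∀ a, 0 ≤ (PA a).toReal := fun a => ENNReal.toReal_nonneg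
  have hP1 : ∀ a, (PA a).toReal ≤ 1 := fun a =>
    ENNReal.toReal_mono ENNReal.one_ne_top (PA.coe_le_one a)
  set T : 𝒳 → ℝ := fun x => (W x * mpow (sandwich (W x) σ) s).trace.re
  calc _ = ∑ φ, q φ * ∑ a, (PA a).toReal * (W (φ a) *
          mpow (sandwich (∑ a', (PA a').toReal • W (φ a')) σ) s).trace.re := by
        refine Finset.sum_congr rfl fun φ _ => ?_
        rw [← output_map, ← trace_output_map_mul_re]
    _ ≤ ∑ a, (PA a).toReal * ∑ x, (PX x).toReal * (W x * mpow (sandwich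
          ((PA a).toReal • W x + (1 - (PA a).toReal) • ∑ y, (PX y).toReal • W y) σ) s).trace.re :=
        sum_concave_codebook_le hq hmarg hpair hP0 (sum_pmf_toReal PA) W (fun x => (hW x).1)
          fun x => concaveOn_trace_mpow_sandwich (hW x).1 σ hs0.le hs1
    _ ≤ ∑ a, (PA a).toReal * ∑ x, (PX x).toReal * (1 + (PA a).toReal ^ s * T x) := by
        rw [← output_eq_sum, ← hσ]
        exact Finset.sum_le_sum fun a _ => mul_le_mul_of_nonneg_left
          (Finset.sum_le_sum fun x _ => mul_le_mul_of_nonneg_left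
            (trace_mul_mpow_sandwich_le (hW x) hσp hs0 hs1 (hP0 a) (hP1 a))
            ENNReal.toReal_nonneg) (hP0 a)
    _ = ∑ a, ((PA a).toReal + (PA a).toReal ^ (1 + s) * ∑ x, (PX x).toReal * T x) := by
        refine Finset.sum_congr rfl fun a _ => ?_
        have e1 : (PA a).toReal * (PA a).toReal ^ s = (PA a).toReal ^ (1 + s) := by
          rw [Real.rpow_add_of_nonneg (hP0 a) zero_le_one hs0.le, Real.rpow_one]
        have e2 : ∑ x, (PX x).toReal * (1 + (PA a).toReal ^ s * T x)
            = 1 + (PA a).toReal ^ s * ∑ x, (PX x).toReal * T x := by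
          rw [← sum_pmf_toReal PX, Finset.mul_sum, ← Finset.sum_add_distrib, sum_pmf_toReal]
          exact Finset.sum_congr rfl fun x _ => by ring
        rw [e2, ← e1]
        ring
    _ = _ := by rw [Finset.sum_add_distrib, sum_pmf_toReal, ← Finset.sum_mul]

end Main

end QResolvability

end

/-- In the first inequality the expectation is that of the positive part of the relative entropy,
which is an upper bound of the expectation of the relative entropy and equal to it, as the
relative entropy of two states is nonnegative. -/
theorem mainTheorem6 {𝒜 𝒳 n Ω : Type*} [Fintype 𝒜] [Fintype 𝒳] [DecidableEq 𝒳]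
    [Fintype n] [DecidableEq n]
    [MeasurableSpace 𝒳] [MeasurableSingletonClass 𝒳]
    [MeasurableSpace Ω] (μ : Measure Ω) [IsProbabilityMeasure μ]
    (W : 𝒳 → Matrix n n ℂ) (hW : ∀ x, QResolvability.IsState (W x))
    (PA : PMF 𝒜) (PX : PMF 𝒳)
    (Φ : 𝒜 → Ω → 𝒳) (hΦ : ∀ a, Measurable (Φ a))
    (hlaw : ∀ a, μ.map (Φ a) = PX.toMeasure)
    (hindep : Pairwise fun a a' => IndepFun (Φ a) (Φ a') μ)
    (s : ℝ) (hs0 : 0 < s) (hs1 : s ≤ 1) :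
    (∫⁻ ω, (QResolvability.relEnt
          (QResolvability.output W (PA.map fun a => Φ a ω))
          (QResolvability.output W PX)).toENNReal ∂μ
        ≤ (QResolvability.numEigenvalues (QResolvability.output W PX) : ℝ≥0∞) ^ s
          * ENNReal.ofReal (Real.exp (-s * QResolvability.renyi s PA))
          * EReal.exp (QResolvability.psiChannel s W PX) / ENNReal.ofReal s)
    ∧ (∫⁻ ω, EReal.exp ((s : EReal) * QResolvability.relEntLow
          (QResolvability.output W (PA.map fun a => Φ a ω))
          (QResolvability.output W PX)) ∂μ
        ≤ ∫⁻ ω, EReal.exp (QResolvability.psiLow s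
          (QResolvability.output W (PA.map fun a => Φ a ω))
          (QResolvability.output W PX)) ∂μ)
    ∧ (∫⁻ ω, EReal.exp (QResolvability.psiLow s
          (QResolvability.output W (PA.map fun a => Φ a ω))
          (QResolvability.output W PX)) ∂μ
        ≤ 1 + ENNReal.ofReal (Real.exp (-s * QResolvability.renyi s PA))
          * EReal.exp (QResolvability.psiLowChannel s W PX)) := by
  classical
  have hq : ∀ φ, 0 ≤ QResolvability.codebookLaw μ Φ φ := fun φ => ENNReal.toReal_nonneg
  have hmarg := QResolvability.codebookLaw_marginal hΦ hlaw
  have hpair : ∀ a a', a ≠ a' → ∀ x x',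
      ∑ φ with φ a = x ∧ φ a' = x', QResolvability.codebookLaw μ Φ φ
        = (PX x).toReal * (PX x').toReal :=
    fun a a' h => QResolvability.codebookLaw_pair hΦ hlaw (hindep h)
  -- A codebook of positive probability uses only letters of positive probability, which gives the
  -- support inclusion.
  have hpos : ∀ φ, QResolvability.codebookLaw μ Φ φ ≠ 0 → ∀ a, PX (φ a) ≠ 0 := by
    intro φ hφ a h0
    have h1 := hmarg a (φ a)
    rw [h0, ENNReal.toReal_zero] at h1
    exact hφ ((Finset.sum_eq_zero_iff_of_nonneg fun φ _ => hq φ).1 h1 φ (by simp))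
  have hsupp : ∀ φ, QResolvability.codebookLaw μ Φ φ ≠ 0 → QResolvability.SuppLE
      (QResolvability.output W (PA.map φ)) (QResolvability.output W PX) := fun φ hφ =>
    QResolvability.suppLE_output_map PA fun a => QResolvability.suppLE_output hW (hpos φ hφ a)
  have hstate := fun φ : 𝒜 → 𝒳 => QResolvability.output_isState hW (PA.map φ)
  have hσ := QResolvability.output_isState hW PX
  refine ⟨?_, lintegral_mono fun ω =>
    QResolvability.exp_mul_relEntLow_le (hstate fun a => Φ a ω) _ hs0, ?_⟩
  · refine (QResolvability.lintegral_codebook_le hΦ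
      (g := fun φ => (QResolvability.relEnt (QResolvability.output W (PA.map φ))
        (QResolvability.output W PX)).toENNReal)
      (fun φ hφ => QResolvability.trace_mul_mlog_sub_mlog_nonneg (hstate φ).1 hσ.1
        ((hstate φ).2.trans hσ.2.symm) (hsupp φ hφ)) fun φ hφ => ?_).trans ?_
    · simp only [QResolvability.relEnt, if_pos (hsupp φ hφ), EReal.toENNReal_of_ne_top
        (EReal.coe_ne_top _), EReal.toReal_coe, le_refl]
    · refine (ENNReal.ofReal_le_ofReal (QResolvability.sum_codebook_relEnt_le hW PA PX hq hmarg
        hpair hs0 hs1)).trans ?_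
      rw [QResolvability.exp_neg_mul_renyi PA hs0, ENNReal.ofReal_div_of_pos hs0,
        ENNReal.ofReal_mul (by positivity), ENNReal.ofReal_mul (by positivity),
        ← ENNReal.ofReal_rpow_of_nonneg (Nat.cast_nonneg _) hs0.le, ENNReal.ofReal_natCast]
      gcongr
      exact QResolvability.le_exp_psiChannel hW PX hs0
  · refine (QResolvability.lintegral_codebook_le hΦ
      (g := fun φ => EReal.exp (QResolvability.psiLow s (QResolvability.output W (PA.map φ))
        (QResolvability.output W PX)))
      (fun φ hφ => QResolvability.trace_mul_nonneg (hstate φ).1 (QResolvability.mpow_posSemidef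
        (QResolvability.sandwich_posSemidef (hstate φ).1 (QResolvability.output W PX)) s))
      fun φ hφ => ?_).trans ?_
    · simp only [QResolvability.psiLow, if_pos (hsupp φ hφ), ENNReal.exp_log, le_refl]
    · refine (ENNReal.ofReal_le_ofReal (QResolvability.sum_codebook_mpow_sandwich_le hW PA PX hq
        hmarg hpair hs0 hs1)).trans ((ENNReal.ofReal_add_le).trans ?_)
      rw [QResolvability.exp_neg_mul_renyi PA hs0, ENNReal.ofReal_one,
        ENNReal.ofReal_mul (by positivity)]
      gcongr
      exact QResolvability.le_exp_psiLowChannel hW PX s
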